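/- Let $\mathcal S$ be a finite state space with finite action sets $\mathcal A(s)$, $\Lambda=\{(s,a):s\in\mathcal S,a\in\mathcal A(s)\}$, transition probabilities $p(s'|s,a)$, initial distribution $q$ and discount factor $\beta\in[0,1)$, and let $$\Delta_{\beta,q}=\Big\{\tau\in\mathbb R^{\Lambda}:\ \tau\ge 0,\ \sum_{(s,a)\in\Lambda}\tau(s,a)\big(\mathbf 1_{s'=s}-\beta p(s'|s,a)\big)=(1-\beta)q(s')\ \ \forall s'\in\mathcal S\Big\}.$$ **Elliptical laws.** $E_d(\mu,\Sigma,\psi)$ (with $\Sigma$ positive semidefinite and $\psi$ real valued) is the law on $\mathbb R^d$ with characteristic function $b\mapsto e^{ib^\top\mu}\,\psi(\tfrac12 b^\top\Sigma b)$. For $k=0,\dots,K$ let $\tilde F_k=\sum_{j=1}^{J_k}\omega_j^k\tilde F_j^k$, where $\omega_j^k\ge 0$, $\sum_j\omega_j^k=1$, and $\tilde F_j^k=E_{|\Lambda|}(\mu_j^k,\Sigma_j^k,\psi_j^k)$ has a Lebesgue density. Let $\Phi_j^k$ be the distribution function of $E_1(0,1,\psi_j^k)$ and $(\Phi_j^k)^{-1}(u)=\sup\{z\in\mathbb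 R:\Phi_j^k(z)\le u\}\in[-\infty,+\infty]$. **Robust problem.** Let $\delta_0,\dots,\delta_K>0$, $\xi_1,\dots,\xi_K\in\mathbb R$, $\hat\epsilon\in(0,1]$. Let $\mathcal F_k=\{F: D_{\rm KL}(F\|\tilde F_k)\le\delta_k\}$ for $k=0,\dots,K$, and $\mathcal F=\{F_1\times\dots\times F_K: F_k\in\mathcal F_k\}$. The K-L J-DRCCMDP problem is $$\text{(R)}\qquad \max_{\tau\in\Delta_{\beta,q}}\ \inf_{F_0\in\mathcal F_0}\tfrac1{1-\beta}\mathbb E_{F_0}[\tau^\top r_0]\quad\text{s.t.}\quad \inf_{F\in\mathcal F}\mathbb P_F(\tau^\top r_k\ge\xi_k,\ k=1,\dots,K)\ge\hat\epsilon .$$ **Assumptions.** For every $j=1,\dots,J_0$: $\Sigma_j^0$ is positive definite, $\mu_j^0\le 0$ componentwise, $\psi_j^0$ is a continuous function on $\mathbb R$ that is real-analytic in a neighbourhood of each point of $(-\infty,0]$ (so that its values at negative arguments are those of the analytic continuation of the characteristic generator), and $\inf_{t\le 0}\min_{1\le j\le J_0}\psi_j^0(t)\ge e^{-\delta_0}$.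 Moreover $\mathbb P_{\tilde F_k}(\tau^\top r_k\ge\xi_k)<1$ for all $\tau\in\Delta_{\beta,q}$ and $k=1,\dots,K$ (automatic if all $\Phi_j^k$ are strictly increasing). **Explicit problem.** $$\begin{aligned}\text{(E)}\qquad\min_{\tau,\alpha,x,y,l,\hat y}\quad&\alpha\log\Big[\sum_{j=1}^{J_0}\omega_j^0\exp\Big(-\frac{\tau^\top\mu_j^0}{\alpha}\Big)\psi_j^0\Big(-\frac{\tau^\top\Sigma_j^0\tau}{2\alpha^2}\Big)\Big]+\alpha\delta_0\\ \text{s.t.}\quad&\tau^\top\mu_j^k+(\Phi_j^k)^{-1}(1-l_j^k)\sqrt{\tau^\top\Sigma_j^k\tau}\ge\xi_k,\quad j=1,\dots,J_k,\ k=1,\dots,K,\\ &\sum_{j=1}^{J_k}\omega_j^k l_j^k\ge\hat y_k,\qquad \hat y_k\ge\frac{e^{-\delta_k}x_k^{y_k}-1}{x_k-1},\quad k=1,\dots,K,\\ &0<x_k<1,\quad 0\le y_k\le1,\quad 0\le\hat y_k\le 1,\quad 0\le l_j^k\le 1,\quad j=1,\dots,J_k,\ k=1,\dots,K,\\ &\prod_{k=1}^K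 y_k\ge\hat\epsilon,\qquad \alpha\ge 0,\qquad \tau\in\Delta_{\beta,q},\end{aligned}$$ where the objective at $\alpha=0$ is its limit in $[-\infty,+\infty]$ as $\alpha\downarrow0$. **Theorem.** Problems (R) and (E) are equivalent. All expectations in (R) exist, and: 1. $\tau$ is feasible for (R) if and only if $(\tau,\alpha,x,y,l,\hat y)$ is feasible for (E) for some $\alpha,x,y,l,\hat y$. 2. For each $\tau\in\Delta_{\beta,q}$ the minimum of the objective of (E) over $\alpha\ge0$ is attained, and the objective of (R) at $\tau$ is $-\frac1{1-\beta}$ times this minimum. 3. The optimal value (supremum) of (R) is $-\frac1{1-\beta}$ times the optimal value (infimum) of (E). 4. $\tau$ is an optimal solution of (R) if and only if it is the $\tau$-part of an optimal solution of (E). -/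

import Mathlib

namespace DRCCMDP

open MeasureTheory Matrix

/-! ### Markov decision processes -/

/-- A finite discounted MDP without rewards: `A s` is the set of actions available in state `s`,
`p s a s'` is the probability of moving from `s` to `s'` under `a`, `q` is the law of the initial
state and `β` is the discount factor. -/
structure MDP (S : Type*) (A : S → Type*) [Fintype S] where
  p : (s : S) → A s → S → ℝ
  q : S → ℝ
  β : ℝ
  p_nonneg : ∀ s a s', 0 ≤ p s a s'
  p_sum : ∀ s a, ∑ s', p s a s' = 1
  q_nonneg : ∀ s, 0 ≤ q s
  q_sum : ∑ s, q s = 1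
  β_nonneg : 0 ≤ β
  β_lt_one : β < 1

/-- The polytope of discounted occupation measures. The index set is the set of all
state-action pairs `(s, a)` with `a ∈ A s`. -/
def MDP.occ {S : Type*} {A : S → Type*} [Fintype S] [DecidableEq S] [∀ s, Fintype (A s)]
    (M : MDP S A) : Set ((Σ s, A s) → ℝ) :=
  {τ | (∀ s', ∑ e : (Σ s, A s), τ e * ((if s' = e.1 then 1 else 0) - M.β * M.p e.1 e.2 s')
          = (1 - M.β) * M.q s') ∧ ∀ e, 0 ≤ τ e}

/-! ### Elliptical laws and mixtures -/

/-- `P` is the elliptical law `E_d(μ, Sg, ψ)` on `ℝ^ι`: it is a probability measure, the dispersion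
matrix `Sg` is positive semidefinite, and the characteristic function is
`b ↦ exp(i bᵀμ) ψ(bᵀ Sg b / 2)`. -/
structure IsElliptical {ι : Type*} [Fintype ι] (P : Measure (ι → ℝ)) (μ : ι → ℝ)
    (Sg : Matrix ι ι ℝ) (ψ : ℝ → ℝ) : Prop where
  isProb : IsProbabilityMeasure P
  posSemidef : Sg.PosSemidef
  charFun_eq : ∀ b : ι → ℝ,
    ∫ x, Complex.exp (Complex.I * ((b ⬝ᵥ x : ℝ) : ℂ)) ∂P
      = Complex.exp (Complex.I * ((b ⬝ᵥ μ : ℝ) : ℂ)) * (ψ ((b ⬝ᵥ (Sg *ᵥ b)) / 2) : ℂ)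

/-- `ν` is the standard one-dimensional elliptical law `E_1(0, 1, ψ)`. -/
structure IsStdElliptical (ν : Measure ℝ) (ψ : ℝ → ℝ) : Prop where
  isProb : IsProbabilityMeasure ν
  charFun_eq : ∀ t : ℝ, charFun ν t = (ψ (t ^ 2 / 2) : ℂ)

/-- The mixture `∑ j, ω j • P j`. -/
noncomputable def mixture {ι : Type*} {J : ℕ} (ω : Fin J → ℝ) (P : Fin J → Measure (ι → ℝ)) :
    Measure (ι → ℝ) :=
  ∑ j, ENNReal.ofReal (ω j) • P j

/-- The inverse `Φ⁻¹(u)` of the distribution function `Φ` of `ν`, with values in `[-∞, +∞]`: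
the supremum of all real `z` with `Φ(z) ≤ u`. Where `Φ` is continuous and strictly increasing this
is the ordinary inverse on `(0, 1)`, with `Φ⁻¹(0) = -∞` and `Φ⁻¹(1) = +∞`. -/
noncomputable def cdfInv (ν : Measure ℝ) (u : ℝ) : EReal :=
  sSup {w : EReal | ∃ z : ℝ, w = (z : EReal) ∧ ProbabilityTheory.cdf ν z ≤ u}

/-! ### Ambiguity sets and the distributionally robust problem -/

/-- The Kullback-Leibler ball of radius `δ` around `R`. -/
def klBall {ι : Type*} (R : Measure (ι → ℝ)) (δ : ℝ) : Set (Measure (ι → ℝ)) :=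
  {F | IsProbabilityMeasure F ∧ InformationTheory.klDiv F R ≤ ENNReal.ofReal δ}

/-- The joint ambiguity set: products of laws taken from the `K` Kullback-Leibler balls. -/
def jointBall {ι : Type*} {K : ℕ} (R : Fin K → Measure (ι → ℝ)) (δ : Fin K → ℝ) :
    Set (Measure (Fin K → ι → ℝ)) :=
  {F | ∃ G : Fin K → Measure (ι → ℝ), (∀ k, G k ∈ klBall (R k) (δ k)) ∧ F = Measure.pi G}

/-- The robust objective `inf_{F ∈ 𝓕₀} (1 / (1 - β)) E_F[τᵀ r]`, to be maximized. -/
noncomputable def robustObjective {ι : Type*} [Fintype ι] (β : ℝ) (R : Measure (ι → ℝ)) (δ : ℝ)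
    (τ : ι → ℝ) : EReal :=
  ⨅ F ∈ klBall R δ, ((1 / (1 - β) * ∫ r, τ ⬝ᵥ r ∂F : ℝ) : EReal)

/-- The feasible set of the joint problem:
`τ ∈ Δ` and `inf_{F ∈ 𝓕} P_F(τᵀ r_k ≥ ξ_k, k = 1, …, K) ≥ ε`. -/
def robustFeasible {ι : Type*} [Fintype ι] {K : ℕ} (Δ : Set (ι → ℝ))
    (R : Fin K → Measure (ι → ℝ)) (δ : Fin K → ℝ) (ξ : Fin K → ℝ) (ε : ℝ) : Set (ι → ℝ) :=
  {τ | τ ∈ Δ ∧ ENNReal.ofReal ε ≤ ⨅ F ∈ jointBall R δ, F {r | ∀ k, ξ k ≤ τ ⬝ᵥ r k}}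

/-! ### The explicit problem -/

/-- The decision variables `(τ, α, x, y, l, ŷ)` of the explicit problem. -/
structure Var (ι : Type*) (K : ℕ) (J : Fin (K + 1) → ℕ) where
  τ : ι → ℝ
  α : ℝ
  x : Fin K → ℝ
  y : Fin K → ℝ
  l : (k : Fin K) → Fin (J k.succ) → ℝ
  yhat : Fin K → ℝ

/-- `α log [∑ j, ω j exp(- τᵀ μ j / α) ψ j (- τᵀ Sg j τ / (2 α ^ 2))] + α δ`, meant for `α > 0`. -/
noncomputable def objectiveFormula {ι : Type*} [Fintype ι] {J : ℕ} (ω : Fin J → ℝ)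
    (μ : Fin J → ι → ℝ) (Sg : Fin J → Matrix ι ι ℝ) (ψ : Fin J → ℝ → ℝ) (δ : ℝ)
    (τ : ι → ℝ) (α : ℝ) : ℝ :=
  α * Real.log (∑ j, ω j * Real.exp (-(τ ⬝ᵥ μ j) / α)
        * ψ j (-(τ ⬝ᵥ (Sg j *ᵥ τ)) / (2 * α ^ 2))) + α * δ

/-- The objective of the explicit problem for `α ≥ 0`, to be minimized; its value at `α = 0` is the
limit, in `[-∞, +∞]`, of the formula as `α` decreases to `0`. -/
noncomputable def explicitObjective {ι : Type*} [Fintype ι] {J : ℕ} (ω : Fin J → ℝ)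
    (μ : Fin J → ι → ℝ) (Sg : Fin J → Matrix ι ι ℝ) (ψ : Fin J → ℝ → ℝ) (δ : ℝ)
    (τ : ι → ℝ) (α : ℝ) : EReal :=
  if α = 0 then
    Filter.liminf (fun a : ℝ => (objectiveFormula ω μ Sg ψ δ τ a : EReal)) (nhdsWithin 0 (Set.Ioi 0))
  else (objectiveFormula ω μ Sg ψ δ τ α : EReal)

/-- The constraints of the explicit problem. The data are indexed by `k = 0, …, K`; the constraints
use `k = 1, …, K`. `Z k j` is the law whose distribution function is `Φ_j^k`. -/
structure IsExplicitFeasible {ι : Type*} [Fintype ι] {K : ℕ} {J : Fin (K + 1) → ℕ}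
    (Δ : Set (ι → ℝ)) (ω : (k : Fin (K + 1)) → Fin (J k) → ℝ)
    (μ : (k : Fin (K + 1)) → Fin (J k) → ι → ℝ)
    (Sg : (k : Fin (K + 1)) → Fin (J k) → Matrix ι ι ℝ)
    (Z : (k : Fin (K + 1)) → Fin (J k) → Measure ℝ)
    (δ : Fin (K + 1) → ℝ) (ξ : Fin K → ℝ) (ε : ℝ) (v : Var ι K J) : Prop where
  component : ∀ (k : Fin K) (j : Fin (J k.succ)),
    (ξ k : EReal) ≤ ((v.τ ⬝ᵥ μ k.succ j : ℝ) : EReal) + cdfInv (Z k.succ j) (1 - v.l k j)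
      * ((Real.sqrt (v.τ ⬝ᵥ (Sg k.succ j *ᵥ v.τ)) : ℝ) : EReal)
  weight : ∀ k : Fin K, v.yhat k ≤ ∑ j, ω k.succ j * v.l k j
  link : ∀ k : Fin K,
    (Real.exp (-δ k.succ) * v.x k ^ v.y k - 1) / (v.x k - 1) ≤ v.yhat k
  x_mem : ∀ k, v.x k ∈ Set.Ioo (0 : ℝ) 1
  y_mem : ∀ k, v.y k ∈ Set.Icc (0 : ℝ) 1
  yhat_mem : ∀ k, v.yhat k ∈ Set.Icc (0 : ℝ) 1
  l_mem : ∀ k j, v.l k j ∈ Set.Icc (0 : ℝ) 1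
  confidence : ε ≤ ∏ k, v.y k
  α_nonneg : 0 ≤ v.α
  τ_mem : v.τ ∈ Δ

end DRCCMDP

/-! Both robust problems are solved by convex duality for Kullback-Leibler balls, the extremal laws
being exponential tilts of the reference law.

Chance constraints. The ambiguity set consists of products, so the joint probability factorises and
each `k` can be treated alone. The Donsker-Varadhan inequality for `log x` times the indicator of an
event bounds its worst-case probability below; a tilt on the boundary of the ball makes the bound
sharp (`le_measureReal_of_certificate`, `exists_certificate`). Reference probabilities are mixtures
of one-dimensional elliptical ones, which turns them into quantile inequalities
(`IsElliptical.component_iff`).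

Objective. For `Y = -τᵀr` with cumulant generating function `Λ`, the worst mean is the minimum over
`s > 0` of `(δ + Λ s) / s`, and `α = 1 / s`. Since `Y` has no atoms, the divergence of its tilts
exceeds `δ`, so some tilt has divergence exactly `δ` and attains the bound at a positive `α`
(`exists_tilted_klDiv_eq`).

The formula for `Λ` requires that analyticity of `ψ` along the negative axis yield all exponential
moments (`integrable_exp_and_mgf_of_charFun`). This is a Pringsheim-type continuation: positive
moments are controlled by Taylor coefficients. -/

namespace DRCCMDP

open MeasureTheory Matrix

/-! ### Kullback-Leibler divergence and tilted measures -/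

section KullbackLeibler

open InformationTheory

variable {Ω : Type*} [MeasurableSpace Ω] {G ν : Measure Ω} {f : Ω → ℝ}

/-- The Donsker-Varadhan inequality on a Kullback-Leibler ball. -/
lemma integral_le_of_klDiv_le [IsProbabilityMeasure G] [IsProbabilityMeasure ν] {δ : ℝ}
    (hδ : 0 ≤ δ) (hG : klDiv G ν ≤ ENNReal.ofReal δ) (hf : Integrable f G)
    (hexp : Integrable (fun x => Real.exp (f x)) ν) :
    ∫ x, f x ∂G ≤ δ + Real.log (∫ x, Real.exp (f x) ∂ν) := by
  have hne : klDiv G ν ≠ ⊤ := ne_top_of_le_ne_top ENNReal.ofReal_ne_top hG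
  obtain ⟨hac, hint⟩ := klDiv_ne_top_iff.1 hne
  have : IsProbabilityMeasure (ν.tilted f) := isProbabilityMeasure_tilted hexp
  have hac' : G ≪ ν.tilted f := hac.trans (absolutelyContinuous_tilted hexp)
  -- The bound is nonnegativity of the divergence of `G` from the tilt of `ν` by `f`.
  have h1 := integral_llr_tilted_right hac hf hexp hint
  have h2 := integral_llr_add_sub_measure_univ_nonneg hac'
    (integrable_llr_tilted_right hac hf hint hexp)
  have h3 : ∫ x, llr G ν x ∂G ≤ δ := by
    rw [← toReal_klDiv_of_measure_eq hac (by simp)]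
    exact ENNReal.toReal_le_of_le_ofReal hδ hG
  simp only [probReal_univ] at h2
  linarith

/-- Young's inequality for the conjugate pair `exp` and `klFun`. -/
lemma mul_le_klFun_add_exp {a b : ℝ} (hb : 0 ≤ b) : b * a ≤ klFun b + Real.exp a := by
  rcases hb.eq_or_lt with rfl | hb
  · have := Real.exp_pos a
    simp [klFun]
    linarith
  · have h1 := Real.add_one_le_exp (a - Real.log b)
    have h2 : b * Real.exp (a - Real.log b) = Real.exp a := by
      rw [Real.exp_sub, Real.exp_log hb]
      field_simp
    have h3 := mul_le_mul_of_nonneg_left h1 hb.le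
    rw [h2] at h3
    simp only [klFun]
    nlinarith

/-- A function with an exponential moment is integrable under every law of finite divergence. -/
lemma integrable_of_klDiv_ne_top [IsFiniteMeasure G] [IsFiniteMeasure ν]
    (hG : klDiv G ν ≠ ⊤) (hf : Measurable f)
    (hexp : Integrable (fun x => Real.exp |f x|) ν) : Integrable f G := by
  obtain ⟨hac, hint⟩ := klDiv_ne_top_iff.1 hG
  rw [← integrable_rnDeriv_smul_iff hac]
  -- Young's inequality with `b = dG/dν` and `a = |f|` supplies the dominating function.
  refine (((integrable_klFun_rnDeriv_iff hac).2 hint).add hexp).mono'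
    (by fun_prop) (ae_of_all _ fun x => ?_)
  simp only [smul_eq_mul, norm_mul, Real.norm_eq_abs, Pi.add_apply,
    abs_of_nonneg ENNReal.toReal_nonneg]
  exact mul_le_klFun_add_exp ENNReal.toReal_nonneg

/-- The log-density of the tilt is `f` minus the log-normaliser; this is the equality case of
Donsker-Varadhan. -/
lemma klDiv_tilted [IsProbabilityMeasure ν] (hf : Integrable f (ν.tilted f))
    (hexp : Integrable (fun x => Real.exp (f x)) ν) :
    klDiv (ν.tilted f) ν
      = ENNReal.ofReal (∫ x, f x ∂(ν.tilted f) - Real.log (∫ x, Real.exp (f x) ∂ν)) := by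
  have : IsProbabilityMeasure (ν.tilted f) := isProbabilityMeasure_tilted hexp
  have hac : ν.tilted f ≪ ν := tilted_absolutelyContinuous ν f
  have h : llr (ν.tilted f) ν =ᵐ[ν.tilted f]
      fun x => f x - Real.log (∫ x, Real.exp (f x) ∂ν) := by
    refine hac.ae_le ?_
    filter_upwards [llr_tilted_left (Measure.AbsolutelyContinuous.refl ν) hexp
      (Real.aemeasurable_of_aemeasurable_exp hexp.1.aemeasurable), llr_self ν] with x h1 h2
    rw [h1, h2]
    simp
  rw [klDiv_of_ac_of_integrable hac ((integrable_congr h).2 (hf.sub (integrable_const _))),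
    integral_congr_ae h, integral_sub hf (integrable_const _)]
  simp

end KullbackLeibler

/-! ### Worst-case probability of an event -/

section Event

open InformationTheory

variable {Ω : Type*} [MeasurableSpace Ω] {G ν : Measure Ω} {E : Set Ω}

lemma exp_indicator_log {Ω : Type*} (E : Set Ω) {x : ℝ} (hx : 0 < x) :
    (fun r => Real.exp (E.indicator (fun _ => Real.log x) r))
      = fun r => 1 + E.indicator (fun _ => x - 1) r := by
  funext r
  by_cases h : r ∈ E <;> simp [h, Real.exp_log hx]

lemma integrable_exp_indicator_log [IsProbabilityMeasure ν] (hE : MeasurableSet E) {x : ℝ}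
    (hx : 0 < x) : Integrable (fun r => Real.exp (E.indicator (fun _ => Real.log x) r)) ν := by
  rw [exp_indicator_log E hx]
  exact (integrable_const _).add ((integrable_const _).indicator hE)

lemma integral_exp_indicator_log [IsProbabilityMeasure ν] (hE : MeasurableSet E) {x : ℝ}
    (hx : 0 < x) :
    ∫ r, Real.exp (E.indicator (fun _ => Real.log x) r) ∂ν = 1 + (x - 1) * ν.real E := by
  rw [exp_indicator_log E hx, integral_add (integrable_const _)
    ((integrable_const _).indicator hE), integral_indicator hE]
  simp [mul_comm]

lemma integral_indicator_log [IsProbabilityMeasure G] (hE : MeasurableSet E) (c : ℝ) :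
    ∫ r, E.indicator (fun _ => c) r ∂G = c * G.real E := by
  rw [integral_indicator hE]
  simp [mul_comm]

/-- A dual certificate `x` bounds the probability of `E` from below on a Kullback-Leibler ball. -/
lemma le_measureReal_of_certificate [IsProbabilityMeasure G] [IsProbabilityMeasure ν]
    (hE : MeasurableSet E) {δ x y : ℝ} (hδ : 0 ≤ δ) (hx : x ∈ Set.Ioo (0 : ℝ) 1)
    (h : (Real.exp (-δ) * x ^ y - 1) / (x - 1) ≤ ν.real E)
    (hG : klDiv G ν ≤ ENNReal.ofReal δ) : y ≤ G.real E := by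
  obtain ⟨hx0, hx1⟩ := hx
  have h1 := integral_le_of_klDiv_le hδ hG
    ((integrable_const (Real.log x)).indicator hE) (integrable_exp_indicator_log hE hx0)
  rw [integral_indicator_log hE, integral_exp_indicator_log hE hx0] at h1
  rw [div_le_iff_of_neg (by linarith)] at h
  have hp : ν.real E ≤ 1 := measureReal_le_one
  have hp0 : 0 ≤ ν.real E := measureReal_nonneg
  have hpos : 0 < 1 + (x - 1) * ν.real E := by nlinarith
  -- The certificate, cleared of its negative denominator and put in logarithms; division by `log x
  -- < 0` then reverses the inequality.
  have h2 : Real.log (1 + (x - 1) * ν.real E) ≤ -δ + Real.log x * y := by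
    rw [Real.log_le_iff_le_exp hpos, Real.exp_add, ← Real.rpow_def_of_pos hx0]
    linarith
  have hlog := Real.log_neg hx0 hx1
  nlinarith

/-- These tilts give points of `E` relative weight `x`; for `x < 1` they are the candidates for the
worst case. -/
lemma measureReal_tilted_indicator_log [IsProbabilityMeasure ν] (hE : MeasurableSet E) {x : ℝ}
    (hx : 0 < x) :
    (ν.tilted (E.indicator fun _ => Real.log x)).real E
      = x * ν.real E / (1 + (x - 1) * ν.real E) := by
  have : IsProbabilityMeasure (ν.tilted (E.indicator fun _ => Real.log x)) :=
    isProbabilityMeasure_tilted (integrable_exp_indicator_log hE hx)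
  have h := integral_indicator_log (G := ν.tilted (E.indicator fun _ => Real.log x)) hE 1
  rw [one_mul] at h
  rw [← h, integral_tilted, integral_exp_indicator_log hE hx]
  have h2 : (fun r => (Real.exp (E.indicator (fun _ => Real.log x) r)
      / (1 + (x - 1) * ν.real E)) • E.indicator (fun _ => (1 : ℝ)) r)
      = E.indicator fun _ => x / (1 + (x - 1) * ν.real E) := by
    funext r
    by_cases h : r ∈ E <;> simp [h, Real.exp_log hx]
  rw [h2, integral_indicator_log hE]
  ring

/-- If `E` is not almost sure and its probability is bounded away from `0` on a Kullback-Leibler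
ball, then the least probability is attained and has a dual certificate. -/
lemma exists_certificate [IsProbabilityMeasure ν] (hE : MeasurableSet E) (hp : ν.real E < 1)
    {δ ε : ℝ} (hδ : 0 < δ) (hε : 0 < ε)
    (h : ∀ G : Measure Ω, IsProbabilityMeasure G → klDiv G ν ≤ ENNReal.ofReal δ → ε ≤ G.real E) :
    ∃ x ∈ Set.Ioo (0 : ℝ) 1, ∃ y ∈ Set.Icc (0 : ℝ) 1,
      (Real.exp (-δ) * x ^ y - 1) / (x - 1) = ν.real E ∧
      ∃ G : Measure Ω, IsProbabilityMeasure G ∧ klDiv G ν ≤ ENNReal.ofReal δ ∧ G.real E = y := by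
  set p := ν.real E with hpdef
  have hp0 : 0 ≤ p := measureReal_nonneg
  have hpos : ∀ x : ℝ, 0 ≤ x → 0 < 1 + (x - 1) * p := fun x hx => by nlinarith
  let q : ℝ → ℝ := fun x => x * p / (1 + (x - 1) * p)
  let D : ℝ → ℝ := fun x => x * Real.log x * p / (1 + (x - 1) * p) - Real.log (1 + (x - 1) * p)
  let T : ℝ → Measure Ω := fun x => ν.tilted (E.indicator fun _ => Real.log x)
  have hT : ∀ x, 0 < x → IsProbabilityMeasure (T x) := fun x hx =>
    isProbabilityMeasure_tilted (integrable_exp_indicator_log hE hx)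
  have hq : ∀ x, 0 < x → (T x).real E = q x := fun x hx => measureReal_tilted_indicator_log hE hx
  have hD : ∀ x, 0 < x → klDiv (T x) ν = ENNReal.ofReal (D x) := fun x hx => by
    have := hT x hx
    rw [klDiv_tilted ((integrable_const _).indicator hE) (integrable_exp_indicator_log hE hx),
      integral_indicator_log hE, integral_exp_indicator_log hE hx, hq x hx]
    simp only [q, D, ← hpdef]
    congr 2
    ring
  by_cases hex : ∃ x ∈ Set.Ioo (0 : ℝ) 1, D x = δ
  · obtain ⟨x, hx, hDx⟩ := hex
    have := hT x hx.1
    refine ⟨x, hx, q x, ?_, ?_, T x, hT x hx.1, by rw [hD x hx.1, hDx], hq x hx.1⟩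
    · rw [← hq x hx.1]
      exact ⟨measureReal_nonneg, measureReal_le_one⟩
    · rw [div_eq_iff (by linarith [hx.2]), Real.rpow_def_of_pos hx.1, ← Real.exp_add]
      have : -δ + Real.log x * q x = Real.log (1 + (x - 1) * p) := by
        rw [← hDx]
        simp only [q, D]
        ring
      rw [this, Real.exp_log (hpos x hx.1.le)]
      ring
  -- If `D` misses `δ`, continuity and `D 1 = 0` keep every tilt inside the ball. As `x ↓ 0` their
  -- mass of `E` tends to `0` (here `p < 1` keeps the denominator positive), against the lower bound
  -- `ε`.
  · exfalso
    push Not at hex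
    have hlt : ∀ x ∈ Set.Ioo (0 : ℝ) 1, D x ≤ δ := by
      intro x hx
      by_contra! hgt
      have hc : ContinuousOn D (Set.Icc x 1) := by
        refine ContinuousOn.sub (ContinuousOn.div ?_ (by fun_prop) fun z hz =>
          (hpos z (hx.1.le.trans hz.1)).ne') (ContinuousOn.log (by fun_prop) fun z hz =>
          (hpos z (hx.1.le.trans hz.1)).ne')
        exact (Real.continuous_mul_log.mul continuous_const).continuousOn
      have h1 : D 1 = 0 := by simp [D]
      obtain ⟨z, hz, hzD⟩ := intermediate_value_Icc' hx.2.le hc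
        (show δ ∈ Set.Icc (D 1) (D x) from ⟨by rw [h1]; exact hδ.le, hgt.le⟩)
      refine hex z ⟨hx.1.trans_le hz.1, lt_of_le_of_ne hz.2 ?_⟩ hzD
      rintro rfl
      linarith
    have hqc : ContinuousAt q 0 :=
      ContinuousAt.div (by fun_prop) (by fun_prop) (hpos 0 le_rfl).ne'
    have hq0 : q 0 < ε := by simpa [q] using hε
    have hev : ∀ᶠ x in nhdsWithin 0 (Set.Ioi 0), q x < ε ∧ x ∈ Set.Ioo (0 : ℝ) 1 :=
      Filter.Eventually.and (nhdsWithin_le_nhds (hqc.eventually (gt_mem_nhds hq0)))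
        (Ioo_mem_nhdsGT one_pos)
    obtain ⟨x, hxq, hx⟩ := hev.exists
    have := h (T x) (hT x hx.1) (by rw [hD x hx.1]; exact ENNReal.ofReal_le_ofReal (hlt x hx))
    rw [hq x hx.1] at this
    linarith

end Event

/-! ### Distribution functions and extended quantiles -/

section Cdf

open ProbabilityTheory Filter Topology

lemma continuous_cdf (m : Measure ℝ) [IsProbabilityMeasure m] (hm : ∀ c, m {c} = 0) :
    Continuous (cdf m) := by
  rw [continuous_iff_continuousAt]
  intro c
  rw [(monotone_cdf m).continuousAt_iff_leftLim_eq_rightLim, (cdf m).rightLim_eq]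
  refine le_antisymm ((monotone_cdf m).leftLim_le le_rfl) ?_
  have h := (cdf m).measure_singleton c
  rw [measure_cdf, hm, eq_comm, ENNReal.ofReal_eq_zero] at h
  linarith

lemma exists_cdf_eq (m : Measure ℝ) [IsProbabilityMeasure m] (hm : ∀ c, m {c} = 0) {u : ℝ}
    (hu : u ∈ Set.Ioo (0 : ℝ) 1) : ∃ a, cdf m a = u := by
  obtain ⟨a, ha⟩ := ((tendsto_cdf_atBot m).eventually (gt_mem_nhds hu.1)).exists
  obtain ⟨b, hb⟩ := ((tendsto_cdf_atTop m).eventually (lt_mem_nhds hu.2)).exists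
  exact mem_range_of_exists_le_of_exists_ge (continuous_cdf m hm) ⟨a, ha.le⟩ ⟨b, hb.le⟩

/-- Every `z < c` lies below some point where the distribution function is at most `u`; continuity
carries the bound to `c` itself. -/
lemma coe_le_cdfInv_iff (m : Measure ℝ) [IsProbabilityMeasure m] (hm : ∀ c, m {c} = 0)
    {c u : ℝ} : (c : EReal) ≤ cdfInv m u ↔ cdf m c ≤ u := by
  refine ⟨fun h => ?_, fun h => le_sSup ⟨c, rfl, h⟩⟩
  refine ContinuousWithinAt.closure_le (s := Set.Iio c) (by simp)
    (continuous_cdf m hm).continuousWithinAt continuousWithinAt_const fun z hz => ?_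
  have hz' : (z : EReal) < cdfInv m u := (EReal.coe_lt_coe_iff.2 hz).trans_le h
  obtain ⟨w, ⟨x, rfl, hx⟩, hw⟩ := lt_sSup_iff.1 hz'
  exact (monotone_cdf m (EReal.coe_lt_coe_iff.1 hw).le).trans hx

/-- Strict positivity of `s` keeps infinite quantiles infinite; in `EReal` their product with `0`
would be `0`. -/
lemma coe_le_add_cdfInv_mul_iff (m : Measure ℝ) [IsProbabilityMeasure m] (hm : ∀ c, m {c} = 0)
    {a b s u : ℝ} (hs : 0 < s) :
    (a : EReal) ≤ (b : EReal) + cdfInv m u * (s : EReal) ↔ cdf m ((a - b) / s) ≤ u := by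
  rw [← coe_le_cdfInv_iff m hm]
  induction cdfInv m u with
  | bot => simp [EReal.bot_mul_coe_of_pos hs]
  | top => simp [EReal.top_mul_coe_of_pos hs]
  | coe w =>
    norm_cast
    rw [div_le_iff₀ hs, sub_le_iff_le_add']

end Cdf

/-! ### Exponential tilts and the worst-case mean -/

section Tilt

open ProbabilityTheory InformationTheory Filter Topology

variable {Ω : Type*} [MeasurableSpace Ω] {ν : Measure Ω} {Y : Ω → ℝ}

lemma interior_integrableExpSet_eq_univ (hexp : ∀ s : ℝ, Integrable (fun x => Real.exp (s * Y x)) ν) :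
    interior (integrableExpSet Y ν) = Set.univ := by
  have : integrableExpSet Y ν = Set.univ := Set.eq_univ_of_forall hexp
  rw [this, interior_univ]

/-- Exponential tilting concentrates on the upper tail. -/
lemma tilted_real_le_le [IsProbabilityMeasure ν]
    (hexp : ∀ s : ℝ, Integrable (fun x => Real.exp (s * Y x)) ν) {a b s : ℝ} (hs : 0 ≤ s) :
    (ν.tilted fun x => s * Y x).real {x | Y x ≤ a} * ν.real {x | b ≤ Y x}
      ≤ Real.exp (-(s * (b - a))) := by
  have hT : IsProbabilityMeasure (ν.tilted fun x => s * Y x) := isProbabilityMeasure_tilted (hexp s)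
  have hpos : 0 < mgf Y ν s := mgf_pos (hexp s)
  have hfun : (fun x => (Real.exp (s * Y x)) • Real.exp (-s * Y x)) = fun _ => 1 := by
    funext x
    rw [smul_eq_mul, ← Real.exp_add]
    simp
  -- Two Chernoff bounds, under the tilt at `-s` and under `ν` at `s`; their moment generating
  -- functions are reciprocal and cancel.
  have h1 := measure_le_le_exp_mul_mgf (μ := ν.tilted fun x => s * Y x) (X := Y) (t := -s) a
    (by linarith) (by
      rw [integrable_tilted_iff (hexp s), hfun]
      exact integrable_const _)
  have h2 : mgf Y (ν.tilted fun x => s * Y x) (-s) = (mgf Y ν s)⁻¹ := by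
    rw [mgf, integral_tilted]
    have : (fun x => (Real.exp (s * Y x) / ∫ x, Real.exp (s * Y x) ∂ν) • Real.exp (-s * Y x))
        = fun _ => (mgf Y ν s)⁻¹ := by
      funext x
      rw [smul_eq_mul, div_mul_eq_mul_div, ← Real.exp_add, mgf]
      simp
    rw [this]
    simp
  have h3 := measure_ge_le_exp_mul_mgf (μ := ν) b hs (hexp s)
  rw [h2, neg_neg] at h1
  calc _ ≤ Real.exp (s * a) * (mgf Y ν s)⁻¹ * (Real.exp (-s * b) * mgf Y ν s) := by
        gcongr
    _ = Real.exp (-(s * (b - a))) := by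
        rw [mul_mul_mul_comm, ← Real.exp_add, inv_mul_cancel₀ hpos.ne', mul_one]
        ring_nf

/-- The mean of `Y` under the tilt is the derivative of the cumulant generating function. The closed
form makes continuity in `s` accessible. -/
lemma klDiv_tilted_mul [IsProbabilityMeasure ν]
    (hexp : ∀ s : ℝ, Integrable (fun x => Real.exp (s * Y x)) ν) (s : ℝ) :
    klDiv (ν.tilted fun x => s * Y x) ν
      = ENNReal.ofReal (s * deriv (cgf Y ν) s - cgf Y ν s) := by
  have hs : s ∈ interior (integrableExpSet Y ν) := by
    rw [interior_integrableExpSet_eq_univ hexp]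
    trivial
  have hT : IsProbabilityMeasure (ν.tilted fun x => s * Y x) := isProbabilityMeasure_tilted (hexp s)
  have hi : Integrable Y (ν.tilted fun x => s * Y x) := by
    have := memLp_tilted_mul hs 1
    exact memLp_one_iff_integrable.1 (by simpa using this)
  rw [klDiv_tilted (hi.const_mul s) (hexp s), integral_const_mul, integral_tilted_mul_self hs]
  rfl

/-- For a non-atomic variable, the divergence of the exponential tilts exceeds every level. -/
lemma exists_lt_klDiv_tilted [IsProbabilityMeasure ν] (hY : Measurable Y)
    (hexp : ∀ s : ℝ, Integrable (fun x => Real.exp (s * Y x)) ν)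
    (hatom : ∀ c, ν {x | Y x = c} = 0) {δ : ℝ} (hδ : 0 ≤ δ) :
    ∃ s : ℝ, 0 ≤ s ∧ ENNReal.ofReal δ < klDiv (ν.tilted fun x => s * Y x) ν := by
  by_contra! hcon
  let m := ν.map Y
  have hmP : IsProbabilityMeasure m := Measure.isProbabilityMeasure_map hY.aemeasurable
  have hm : ∀ c, m {c} = 0 := fun c => by
    rw [Measure.map_apply hY (measurableSet_singleton c)]
    exact hatom c
  have htail : ∀ a, ν.real {x | a < Y x} = 1 - cdf m a := fun a => by
    rw [cdf_eq_real, ← probReal_compl_eq_one_sub measurableSet_Iic,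
      map_measureReal_apply hY measurableSet_Iic.compl]
    congr 1
    ext x
    simp
  -- `κ > δ + 1/2` and `exp κ * η = 1/2` are chosen so that a law in the ball cannot put almost all
  -- its mass on an event of reference probability `η`.
  set κ : ℝ := δ + 2
  set η : ℝ := 1 / (2 * Real.exp κ)
  have hκ : 1 < Real.exp κ := Real.one_lt_exp_iff.2 (by positivity)
  have hη0 : 0 < η := by positivity
  have hηκ : Real.exp κ * η = 1 / 2 := by simp only [η]; field_simp
  have hη1 : η < 1 := by nlinarith
  obtain ⟨a, ha⟩ := exists_cdf_eq m hm (u := 1 - η) ⟨by linarith, by linarith⟩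
  obtain ⟨b, hb⟩ := exists_cdf_eq m hm (u := 1 - η / 2) ⟨by linarith, by linarith⟩
  have hab : a < b := by
    by_contra! h
    have := monotone_cdf m h
    linarith
  have hbpos : η / 2 ≤ ν.real {x | b ≤ Y x} := by
    have : ν.real {x | b < Y x} ≤ ν.real {x | b ≤ Y x} :=
      measureReal_mono fun x (hx : b < Y x) => hx.le
    rw [htail, hb] at this
    linarith
  have hmeas : MeasurableSet {x | a < Y x} := measurableSet_lt measurable_const hY
  have key : ∀ s : ℝ, 0 ≤ s → (1 / (2 * κ)) * (η / 2) ≤ Real.exp (-(s * (b - a))) := by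
    intro s hs
    have hT : IsProbabilityMeasure (ν.tilted fun x => s * Y x) :=
      isProbabilityMeasure_tilted (hexp s)
    refine le_trans ?_ (tilted_real_le_le hexp (a := a) (b := b) hs)
    -- Donsker-Varadhan with `κ` times the indicator of `{a < Y}` gives this event mass at most `(δ
    -- + 1/2) / κ`, so `{Y ≤ a}` keeps a fixed mass under every tilt, which contradicts
    -- concentration on the upper tail.
    have h1 := integral_le_of_klDiv_le hδ (hcon s hs)
      ((integrable_const (Real.log (Real.exp κ))).indicator hmeas)
      (integrable_exp_indicator_log hmeas (Real.exp_pos κ))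
    rw [integral_indicator_log hmeas, integral_exp_indicator_log hmeas (Real.exp_pos κ),
      Real.log_exp, htail, ha] at h1
    have h2 : Real.log (1 + (Real.exp κ - 1) * (1 - (1 - η))) ≤ 1 / 2 := by
      have h3 : 0 < 1 + (Real.exp κ - 1) * (1 - (1 - η)) := by nlinarith
      have := Real.log_le_sub_one_of_pos h3
      nlinarith
    have h4 : {x | Y x ≤ a} = {x | a < Y x}ᶜ := by
      ext x
      simp
    have h5 := probReal_compl_eq_one_sub (μ := ν.tilted fun x => s * Y x) hmeas
    rw [← h4] at h5
    have hκ0 : 0 < κ := by positivity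
    refine mul_le_mul ?_ hbpos (by positivity) measureReal_nonneg
    rw [h5, div_le_iff₀ (by positivity)]
    have : κ = δ + 2 := rfl
    nlinarith
  have hlim : Tendsto (fun s : ℝ => Real.exp (-(s * (b - a)))) atTop (𝓝 0) :=
    Real.tendsto_exp_neg_atTop_nhds_zero.comp (tendsto_id.atTop_mul_const (sub_pos.2 hab))
  have hκ0 : 0 < κ := by positivity
  have hc : 0 < (1 / (2 * κ)) * (η / 2) := by positivity
  obtain ⟨s, hs, hs0⟩ := ((hlim.eventually (gt_mem_nhds hc)).and (eventually_ge_atTop 0)).exists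
  exact (key s hs0).not_gt hs

/-- Some exponential tilt lies on the boundary of the Kullback-Leibler ball, and its mean is the
dual bound at the corresponding multiplier. -/
lemma exists_tilted_klDiv_eq [IsProbabilityMeasure ν] (hY : Measurable Y)
    (hexp : ∀ s : ℝ, Integrable (fun x => Real.exp (s * Y x)) ν)
    (hatom : ∀ c, ν {x | Y x = c} = 0) {δ : ℝ} (hδ : 0 < δ) :
    ∃ s : ℝ, 0 < s ∧ ∃ G : Measure Ω, IsProbabilityMeasure G ∧ klDiv G ν ≤ ENNReal.ofReal δ ∧
      ∫ x, Y x ∂G = (δ + cgf Y ν s) / s := by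
  have huniv := interior_integrableExpSet_eq_univ hexp
  obtain ⟨s₁, hs₁, h₁⟩ := exists_lt_klDiv_tilted hY hexp hatom hδ.le
  rw [klDiv_tilted_mul hexp] at h₁
  have h₁' := (ENNReal.ofReal_lt_ofReal_iff_of_nonneg hδ.le).1 h₁
  have hcont : Continuous fun s => s * deriv (cgf Y ν) s - cgf Y ν s := by
    have hc : AnalyticOnNhd ℝ (cgf Y ν) Set.univ := huniv ▸ analyticOnNhd_cgf
    exact (continuous_id.mul (continuousOn_univ.1 hc.deriv.continuousOn)).sub
      (continuousOn_univ.1 hc.continuousOn)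
  obtain ⟨s, hs, hsδ⟩ := intermediate_value_Icc hs₁ hcont.continuousOn
    (show δ ∈ Set.Icc _ _ from ⟨by simpa using hδ.le, h₁'.le⟩)
  have hs0 : 0 < s := by
    refine lt_of_le_of_ne hs.1 ?_
    rintro rfl
    simp at hsδ
    linarith
  refine ⟨s, hs0, ν.tilted fun x => s * Y x, isProbabilityMeasure_tilted (hexp s), ?_, ?_⟩
  · rw [klDiv_tilted_mul hexp]
    exact ENNReal.ofReal_le_ofReal hsδ.le
  -- With `Λ` for the cumulant generating function, `s Λ'(s) - Λ(s) = δ` is solved for the mean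
  -- `Λ'(s)`.
  · rw [integral_tilted_mul_self (by rw [huniv]; trivial), eq_div_iff hs0.ne']
    simp only at hsδ
    linarith

lemma integrable_of_klDiv_le_of_exp {G : Measure Ω} [IsProbabilityMeasure G]
    [IsProbabilityMeasure ν] (hY : Measurable Y)
    (hexp : ∀ s : ℝ, Integrable (fun x => Real.exp (s * Y x)) ν) {δ : ℝ}
    (hG : klDiv G ν ≤ ENNReal.ofReal δ) : Integrable Y G := by
  refine integrable_of_klDiv_ne_top (ne_top_of_le_ne_top ENNReal.ofReal_ne_top hG) hY ?_
  have := integrable_exp_mul_abs (hexp 1) (hexp (-1))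
  simpa using this

lemma integral_le_of_klDiv_le_of_exp {G : Measure Ω} [IsProbabilityMeasure G]
    [IsProbabilityMeasure ν] (hY : Measurable Y)
    (hexp : ∀ s : ℝ, Integrable (fun x => Real.exp (s * Y x)) ν) {δ : ℝ} (hδ : 0 ≤ δ)
    (hG : klDiv G ν ≤ ENNReal.ofReal δ) {s : ℝ} (hs : 0 < s) :
    ∫ x, Y x ∂G ≤ (δ + cgf Y ν s) / s := by
  have h := integral_le_of_klDiv_le hδ hG
    ((integrable_of_klDiv_le_of_exp hY hexp hG).const_mul s) (hexp s)
  rw [integral_const_mul] at h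
  rw [le_div_iff₀ hs, mul_comm]
  exact h

end Tilt

/-! ### Decoupling the joint chance constraint -/

section Feasible

open InformationTheory

variable {ι : Type*} [Fintype ι] {K : ℕ}

lemma measurableSet_le_dotProduct (c : ℝ) (τ : ι → ℝ) : MeasurableSet {r | c ≤ τ ⬝ᵥ r} :=
  measurableSet_le measurable_const (by unfold dotProduct; fun_prop)

/-- The joint chance constraint splits into one dual certificate for each `k`. -/
lemma mem_robustFeasible_iff (Δ : Set (ι → ℝ)) (ν : Fin K → Measure (ι → ℝ))
    [∀ k, IsProbabilityMeasure (ν k)] (δ ξ : Fin K → ℝ) (ε : ℝ) (hδ : ∀ k, 0 < δ k) (hε : 0 < ε)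
    {τ : ι → ℝ} (hlt : ∀ k, ν k {r | ξ k ≤ τ ⬝ᵥ r} < 1) :
    τ ∈ robustFeasible Δ ν δ ξ ε ↔ τ ∈ Δ ∧ ∃ x y : Fin K → ℝ,
      (∀ k, x k ∈ Set.Ioo (0 : ℝ) 1) ∧ (∀ k, y k ∈ Set.Icc (0 : ℝ) 1) ∧
      (∀ k, (Real.exp (-δ k) * x k ^ y k - 1) / (x k - 1) ≤ (ν k).real {r | ξ k ≤ τ ⬝ᵥ r}) ∧
      ε ≤ ∏ k, y k := by
  have hmeas := fun k => measurableSet_le_dotProduct (ξ k) τ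
  have hset : {r : Fin K → ι → ℝ | ∀ k, ξ k ≤ τ ⬝ᵥ r k}
      = Set.univ.pi fun k => {r | ξ k ≤ τ ⬝ᵥ r} := by
    ext r
    simp
  have hpi : ∀ G : Fin K → Measure (ι → ℝ), (∀ k, IsProbabilityMeasure (G k)) →
      Measure.pi G {r | ∀ k, ξ k ≤ τ ⬝ᵥ r k}
        = ENNReal.ofReal (∏ k, (G k).real {r | ξ k ≤ τ ⬝ᵥ r}) := by
    intro G hG
    rw [hset, Measure.pi_pi, ENNReal.ofReal_prod_of_nonneg fun k _ => measureReal_nonneg]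
    simp
  simp only [robustFeasible, Set.mem_ofPred_eq, le_iInf_iff]
  refine and_congr_right fun _ => ⟨fun h => ?_, ?_⟩
  · have h' : ∀ G : Fin K → Measure (ι → ℝ), (∀ k, IsProbabilityMeasure (G k)) →
        (∀ k, klDiv (G k) (ν k) ≤ ENNReal.ofReal (δ k)) →
        ε ≤ ∏ k, (G k).real {r | ξ k ≤ τ ⬝ᵥ r} := by
      intro G hG hkl
      have := h (Measure.pi G) ⟨G, fun k => ⟨hG k, hkl k⟩, rfl⟩
      rw [hpi G hG] at this
      exact (ENNReal.ofReal_le_ofReal_iff (Finset.prod_nonneg fun k _ => measureReal_nonneg)).1 this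
    have hex : ∀ k, ∃ x ∈ Set.Ioo (0 : ℝ) 1, ∃ y ∈ Set.Icc (0 : ℝ) 1,
        (Real.exp (-δ k) * x ^ y - 1) / (x - 1) = (ν k).real {r | ξ k ≤ τ ⬝ᵥ r} ∧
        ∃ G : Measure (ι → ℝ), IsProbabilityMeasure G ∧ klDiv G (ν k) ≤ ENNReal.ofReal (δ k) ∧
          G.real {r | ξ k ≤ τ ⬝ᵥ r} = y := by
      intro k
      refine exists_certificate (hmeas k) ?_ (hδ k) hε fun G hG hkl => ?_
      · exact (ENNReal.toReal_lt_toReal (measure_ne_top _ _) ENNReal.one_ne_top).2 (hlt k)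
      -- Only the `k`-th marginal is perturbed. The other factors are at most `1`, so `ε` bounds the
      -- `k`-th factor alone.
      · have hP : ∀ i, IsProbabilityMeasure (Function.update ν k G i) := by
          intro i
          by_cases hi : i = k
          · subst hi; simpa using hG
          · simpa [hi] using inferInstanceAs (IsProbabilityMeasure (ν i))
        refine (h' (Function.update ν k G) hP fun i => ?_).trans ?_
        · by_cases hi : i = k
          · subst hi; simpa using hkl
          · simp [hi]
        · rw [← Finset.mul_prod_erase _ _ (Finset.mem_univ k), Function.update_self]
          refine mul_le_of_le_one_right measureReal_nonneg
            (Finset.prod_le_one (fun i _ => measureReal_nonneg) fun i _ => ?_)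
          have := hP i
          exact measureReal_le_one
    choose x hx y hy hxy G hG hkl hGy using hex
    refine ⟨x, y, hx, hy, fun k => (hxy k).le, ?_⟩
    -- The separate worst-case laws form one admissible product.
    simpa only [hGy] using h' G hG hkl
  · rintro ⟨x, y, hx, hy, hxy, hprod⟩ F ⟨G, hG, rfl⟩
    rw [hpi G fun k => (hG k).1]
    refine ENNReal.ofReal_le_ofReal (hprod.trans (Finset.prod_le_prod (fun k _ => (hy k).1) ?_))
    intro k _
    have := (hG k).1
    exact le_measureReal_of_certificate (hmeas k) (hδ k).le (hx k) (hxy k) (hG k).2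

end Feasible

/-! ### Moments from analyticity of the characteristic function -/

section CharFun

open ProbabilityTheory Filter Topology
open scoped NNReal ENNReal

/-- If the characteristic function is analytic at `0`, then the second moment is finite. -/
lemma integrable_sq_of_analyticAt_charFun (m : Measure ℝ) [IsFiniteMeasure m]
    (h : AnalyticAt ℝ (charFun m) 0) : Integrable (fun x => x ^ 2) m := by
  obtain ⟨p, hp⟩ := h
  -- The linear Taylor terms cancel in the symmetric second difference, which equals `-∫ 2 (1 - cos
  -- (t x))`.
  have hO : (fun t : ℝ => charFun m t + charFun m (-t) - 2 * charFun m 0)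
      =O[𝓝 0] fun t => t ^ 2 := by
    have h1 := hp.isBigO_sub_partialSum_pow 2
    have h2 : (fun t : ℝ => charFun m (0 + -t) - p.partialSum 2 (-t)) =O[𝓝 0] fun t => ‖-t‖ ^ 2 :=
      h1.comp_tendsto (k := fun t : ℝ => -t) (by simpa using! (continuous_neg (G := ℝ)).tendsto 0)
    have h3 := h1.add (by simpa only [norm_neg] using h2)
    have h0 : p 0 (fun _ => (0 : ℝ)) = charFun m 0 := hp.coeff_zero _
    refine (h3.congr_left fun t => ?_).trans (Asymptotics.isBigO_of_le _ fun t => by simp)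
    have hz : ∀ v : Fin 0 → ℝ, p 0 v = charFun m 0 := fun v => hp.coeff_zero _
    have hneg : p 1 (fun _ => -t) = - p 1 (fun _ => t) := by simp
    simp only [FormalMultilinearSeries.partialSum, Finset.sum_range_succ, Finset.sum_range_zero, hz,
      hneg, zero_add]
    ring
  obtain ⟨C, hC⟩ := hO.bound
  have hre : ∀ t : ℝ, ‖charFun m t + charFun m (-t) - 2 * charFun m 0‖
      = ∫ x, 2 * (1 - Real.cos (t * x)) ∂m := by
    intro t
    have hint : ∀ s : ℝ, Integrable (fun x : ℝ => Complex.exp (s * x * Complex.I)) m := fun s =>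
      (integrable_const (1 : ℝ)).mono' (by fun_prop) (ae_of_all _ fun x => by
        rw [← Complex.ofReal_mul, Complex.norm_exp_ofReal_mul_I])
    have : charFun m t + charFun m (-t) - 2 * charFun m 0
        = ((-∫ x, 2 * (1 - Real.cos (t * x)) ∂m : ℝ) : ℂ) := by
      simp only [charFun_apply_real]
      have hadd : Integrable (fun x : ℝ => Complex.exp (t * x * Complex.I)
          + Complex.exp ((-t : ℝ) * x * Complex.I)) m := (hint t).add (hint (-t))
      rw [← integral_add (hint t) (hint (-t)), ← integral_const_mul,
        ← integral_sub hadd ((hint 0).const_mul 2), ← integral_neg,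
        ← integral_complex_ofReal]
      refine integral_congr_ae (ae_of_all _ fun x => ?_)
      simp only [Complex.ofReal_zero, zero_mul, Complex.exp_zero]
      push_cast
      have := Complex.two_cos (t * x : ℂ)
      rw [neg_mul] at this
      simp only [neg_mul]
      rw [← this]
      ring
    rw [this, Complex.norm_real, norm_neg, Real.norm_of_nonneg]
    refine integral_nonneg fun x => ?_
    have := Real.cos_le_one (t * x)
    simp only [Pi.zero_apply]
    linarith
  -- The factor comes from `1 - cos u ≥ 2 u² / π²` for `|u| ≤ π`: with `u = x / n`, `g n x`
  -- eventually dominates `x²`, and Fatou's lemma applies.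
  let g : ℕ → ℝ → ℝ := fun n x =>
    Real.pi ^ 2 / 2 * ((n : ℝ) ^ 2 * (1 - Real.cos ((n : ℝ)⁻¹ * x)))
  have hbound : ∀ᶠ n : ℕ in atTop, ∫⁻ x, ENNReal.ofReal (g n x) ∂m
      ≤ ENNReal.ofReal (Real.pi ^ 2 / 4 * C) := by
    have hlim : Tendsto (fun n : ℕ => (n : ℝ)⁻¹) atTop (𝓝 0) := tendsto_inv_atTop_nhds_zero_nat
    filter_upwards [hlim.eventually hC, eventually_gt_atTop 0] with n hn hn0
    rw [hre] at hn
    have hi : Integrable (g n) m := by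
      refine Integrable.const_mul (Integrable.const_mul ?_ _) _
      refine (integrable_const (2 : ℝ)).mono' (by fun_prop) (ae_of_all _ fun x => ?_)
      have h1 := Real.cos_le_one ((n : ℝ)⁻¹ * x)
      have h2 := Real.neg_one_le_cos ((n : ℝ)⁻¹ * x)
      rw [Real.norm_eq_abs, abs_le]
      constructor <;> linarith
    rw [← ofReal_integral_eq_lintegral_ofReal hi (ae_of_all _ fun x => ?_)]
    · refine ENNReal.ofReal_le_ofReal ?_
      simp only [g]
      rw [integral_const_mul, integral_const_mul]
      rw [integral_const_mul] at hn
      have hn1 : (0 : ℝ) < n := by exact_mod_cast hn0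
      have : (n : ℝ) ^ 2 * (2 * ∫ x, (1 - Real.cos ((n : ℝ)⁻¹ * x)) ∂m) ≤ C := by
        refine (mul_le_mul_of_nonneg_left hn (by positivity)).trans (le_of_eq ?_)
        rw [Real.norm_of_nonneg (by positivity)]
        field_simp
      have hpi := sq_nonneg Real.pi
      nlinarith
    · have := Real.cos_le_one ((n : ℝ)⁻¹ * x)
      have : 0 ≤ 1 - Real.cos ((n : ℝ)⁻¹ * x) := by linarith
      simp only [g, Pi.zero_apply]
      positivity
  have hpt : ∀ x : ℝ, ENNReal.ofReal (x ^ 2) ≤ liminf (fun n => ENNReal.ofReal (g n x)) atTop := by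
    intro x
    refine le_liminf_of_le (by isBoundedDefault) ?_
    have hlim : Tendsto (fun n : ℕ => |(n : ℝ)⁻¹ * x|) atTop (𝓝 0) := by
      simpa using ((tendsto_inv_atTop_nhds_zero_nat (𝕜 := ℝ)).mul_const x).abs
    filter_upwards [hlim.eventually (ge_mem_nhds Real.pi_pos), eventually_gt_atTop 0] with n hn hn0
    have hn1 : (0 : ℝ) < n := by exact_mod_cast hn0
    refine ENNReal.ofReal_le_ofReal ?_
    have h1 := Real.cos_le_one_sub_mul_cos_sq hn
    have h2 : 2 / Real.pi ^ 2 * ((n : ℝ)⁻¹ * x) ^ 2 ≤ 1 - Real.cos ((n : ℝ)⁻¹ * x) := by linarith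
    have h3 : x ^ 2 = Real.pi ^ 2 / 2 * ((n : ℝ) ^ 2 * (2 / Real.pi ^ 2 * ((n : ℝ)⁻¹ * x) ^ 2)) := by
      have := Real.pi_pos
      field_simp
    rw [h3]
    simp only [g]
    gcongr
  have hfin : ∫⁻ x, ENNReal.ofReal (x ^ 2) ∂m < ⊤ := by
    calc ∫⁻ x, ENNReal.ofReal (x ^ 2) ∂m
        ≤ ∫⁻ x, liminf (fun n => ENNReal.ofReal (g n x)) atTop ∂m := lintegral_mono hpt
      _ ≤ liminf (fun n => ∫⁻ x, ENNReal.ofReal (g n x) ∂m) atTop :=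
          lintegral_liminf_le fun n => by fun_prop
      _ ≤ ENNReal.ofReal (Real.pi ^ 2 / 4 * C) :=
          liminf_le_of_frequently_le' hbound.frequently
      _ < ⊤ := ENNReal.ofReal_lt_top
  exact (lintegral_ofReal_ne_top_iff_integrable (by fun_prop)
    (ae_of_all _ fun x => sq_nonneg x)).1 hfin.ne

lemma memLp_of_integrable_even_pow {m : Measure ℝ} {n : ℕ}
    (h : Integrable (fun x : ℝ => x ^ (2 * n)) m) : MemLp id ((2 * n : ℕ) : ℝ≥0∞) m := by
  rcases Nat.eq_zero_or_pos n with rfl | hn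
  · simpa using (aestronglyMeasurable_id : AEStronglyMeasurable id m)
  · rw [← integrable_norm_rpow_iff aestronglyMeasurable_id
      (by exact_mod_cast (by omega : 2 * n ≠ 0)) (ENNReal.natCast_ne_top _)]
    refine h.congr (ae_of_all _ fun x => ?_)
    simp only [id, ENNReal.toReal_natCast, Real.rpow_natCast, Real.norm_eq_abs]
    rw [Even.pow_abs (even_two_mul n)]

/-- If the characteristic function is analytic at `0`, then all even moments are finite. -/
lemma integrable_even_pow_of_analyticAt_charFun (m : Measure ℝ) [IsFiniteMeasure m]
    (h : AnalyticAt ℝ (charFun m) 0) (n : ℕ) : Integrable (fun x => x ^ (2 * n)) m := by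
  induction n with
  | zero => simp
  | succ n ih =>
    have hpos : ∀ x : ℝ, 0 ≤ x ^ (2 * n) := fun x => (even_two_mul n).pow_nonneg x
    have hmem := memLp_of_integrable_even_pow ih
    let d : ℝ → ℝ≥0 := fun x => (x ^ (2 * n)).toNNReal
    have hd : Measurable d := by fun_prop
    -- The characteristic function of the reweighted law is, up to sign, the `2n`-th derivative of
    -- the original, hence analytic at `0`; its second moment is the next even moment of `m`.
    let m' := m.withDensity fun x => (d x : ℝ≥0∞)
    have hfin : IsFiniteMeasure m' := isFiniteMeasure_withDensity_ofReal ih.2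
    have hchar : charFun m' = fun t => (Complex.I ^ (2 * n))⁻¹ * iteratedDeriv (2 * n) (charFun m) t := by
      funext t
      rw [iteratedDeriv_charFun hmem, inv_mul_cancel_left₀ (by simp), charFun_apply_real,
        integral_withDensity_eq_integral_smul hd]
      refine integral_congr_ae (ae_of_all _ fun x => ?_)
      simp only [d, NNReal.smul_def, Real.coe_toNNReal _ (hpos x), Complex.real_smul]
      push_cast
      rfl
    have han : AnalyticAt ℝ (charFun m') 0 := by
      rw [hchar]
      rw [iteratedDeriv_eq_iterate]
      exact analyticAt_const.mul (h.iterated_deriv _)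
    have h2 := integrable_sq_of_analyticAt_charFun m' han
    rw [integrable_withDensity_iff_integrable_smul hd] at h2
    refine h2.congr (ae_of_all _ fun x => ?_)
    simp only [d, NNReal.smul_def, Real.coe_toNNReal _ (hpos x), smul_eq_mul]
    ring

/-- Even moments growing no faster than the derivatives of an analytic function give a finite
hyperbolic cosine moment. -/
lemma integrable_mul_cosh {m : Measure ℝ} {w : ℝ → ℝ} (hw : Measurable w) (hw0 : ∀ x, 0 ≤ w x)
    {V : Type*} [NormedAddCommGroup V] [NormedSpace ℝ V] [CompleteSpace V] {f : ℝ → V}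
    {p : FormalMultilinearSeries ℝ ℝ V} {s : ℝ} {r : ℝ≥0∞} (hp : HasFPowerSeriesOnBall f p s r)
    {h : ℝ≥0} (hr : (h : ℝ≥0∞) < r) (hint : ∀ n : ℕ, Integrable (fun x => w x * x ^ (2 * n)) m)
    (hmom : ∀ n : ℕ, ∫ x, w x * x ^ (2 * n) ∂m ≤ ‖iteratedDeriv (2 * n) f s‖) :
    Integrable (fun x => w x * Real.cosh (h * x)) m := by
  have hsum : Summable fun n => ‖p (2 * n)‖ * (h : ℝ) ^ (2 * n) :=
    (p.summable_norm_mul_pow (hr.trans_le hp.r_le)).comp_injective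
      (mul_right_injective₀ two_ne_zero)
  have hnn : ∀ n x, 0 ≤ w x * x ^ (2 * n) := fun n x =>
    mul_nonneg (hw0 x) ((even_two_mul n).pow_nonneg x)
  -- Terms of the `cosh` series. All are nonnegative, so they integrate termwise and are bounded by
  -- the even part of a convergent series of Taylor-coefficient norms.
  let a : ℕ → ℝ → ℝ := fun n x => w x * x ^ (2 * n) * ((h : ℝ) ^ (2 * n) / (2 * n).factorial)
  have ha0 : ∀ n x, 0 ≤ a n x := fun n x => mul_nonneg (hnn n x) (by positivity)
  have ha : ∀ x, HasSum (fun n => a n x) (w x * Real.cosh (h * x)) := fun x => by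
    refine ((Real.hasSum_cosh (h * x)).mul_left (w x)).congr_fun ?_
    intro n
    simp only [a, mul_pow]
    ring
  have hle : ∀ n, ∫⁻ x, ENNReal.ofReal (a n x) ∂m
      ≤ ENNReal.ofReal (‖p (2 * n)‖ * (h : ℝ) ^ (2 * n)) := by
    intro n
    rw [← ofReal_integral_eq_lintegral_ofReal ((hint n).mul_const _) (ae_of_all _ (ha0 n))]
    refine ENNReal.ofReal_le_ofReal ?_
    rw [integral_mul_const]
    have h1 : ‖iteratedDeriv (2 * n) f s‖ ≤ (2 * n).factorial * ‖p (2 * n)‖ := by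
      rw [iteratedDeriv_eq_iteratedFDeriv, ← hp.factorial_smul, ← Nat.cast_smul_eq_nsmul ℝ,
        norm_smul]
      rw [Real.norm_natCast]
      gcongr
      simp
    calc _ ≤ ((2 * n).factorial * ‖p (2 * n)‖) * ((h : ℝ) ^ (2 * n) / (2 * n).factorial) := by
          gcongr
          exact (hmom n).trans h1
      _ = _ := by field_simp
  have hmeas : AEStronglyMeasurable (fun x => w x * Real.cosh (h * x)) m := by fun_prop
  refine (lintegral_ofReal_ne_top_iff_integrable hmeas
    (ae_of_all _ fun x => mul_nonneg (hw0 x) (Real.cosh_pos _).le)).1 ?_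
  have heq : ∀ x, ENNReal.ofReal (w x * Real.cosh (h * x)) = ∑' n, ENNReal.ofReal (a n x) :=
    fun x => by
      rw [← (ha x).tsum_eq, ENNReal.ofReal_tsum_of_nonneg (fun n => ha0 n x) (ha x).summable]
  simp_rw [heq]
  rw [lintegral_tsum fun n => by fun_prop]
  refine ne_top_of_le_ne_top ?_ (ENNReal.tsum_le_tsum hle)
  rw [← ENNReal.ofReal_tsum_of_nonneg (fun n => by positivity) hsum]
  exact ENNReal.ofReal_ne_top

lemma integrable_exp_of_integrable_cosh {m : Measure ℝ} {s h t : ℝ}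
    (hi : Integrable (fun x => Real.exp (s * x) * Real.cosh (h * x)) m)
    (ht : |t - s| ≤ |h|) : Integrable (fun x => Real.exp (t * x)) m := by
  refine (hi.const_mul 2).mono' (by fun_prop) (ae_of_all _ fun x => ?_)
  have h1 : Real.exp (t * x) = Real.exp (s * x) * Real.exp ((t - s) * x) := by
    rw [← Real.exp_add]
    ring_nf
  rw [Real.norm_of_nonneg (Real.exp_pos _).le, h1, mul_left_comm]
  gcongr
  calc Real.exp ((t - s) * x) ≤ Real.exp |h * x| := by
        rw [Real.exp_le_exp, abs_mul]
        refine (le_abs_self _).trans ?_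
        rw [abs_mul]
        gcongr
    _ ≤ 2 * Real.cosh |h * x| := by
        rw [Real.cosh_eq]
        have := Real.exp_pos (-|h * x|)
        linarith
    _ = 2 * Real.cosh (h * x) := by rw [Real.cosh_abs]

/-- A real-analytic germ extends to a complex-analytic germ. -/
lemma exists_analyticAt_complex {f : ℝ → ℝ} (hf : AnalyticAt ℝ f 0) :
    ∃ F : ℂ → ℂ, AnalyticAt ℂ F 0 ∧ ∀ᶠ u : ℝ in 𝓝 0, F u = f u := by
  obtain ⟨p, r, hp⟩ := hf
  let c : ℕ → ℂ := fun n => (p.coeff n : ℂ)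
  let q : FormalMultilinearSeries ℂ ℂ ℂ := FormalMultilinearSeries.ofScalars ℂ c
  -- The coefficients are unchanged, so the radius of convergence is too.
  have hnorm : ∀ n, ‖q n‖ = ‖p n‖ := fun n => by
    simp [q, c]
  have hrad : q.radius = p.radius := by
    unfold FormalMultilinearSeries.radius
    simp_rw [hnorm]
  have hq0 : 0 < q.radius := hrad ▸ (hp.r_pos.trans_le hp.r_le)
  have hq := q.hasFPowerSeriesOnBall hq0
  refine ⟨q.sum, hq.analyticAt, ?_⟩
  filter_upwards [Metric.eball_mem_nhds (0 : ℝ) hp.r_pos] with u hu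
  have h1 : HasSum (fun n => p.coeff n * u ^ n) (f u) := by
    have := hp.hasSum hu
    simpa [mul_comm] using this
  have h2 := Complex.hasSum_ofReal.2 h1
  have h3 : q.sum u = ∑' n, c n • (u : ℂ) ^ n := by
    simp only [q, FormalMultilinearSeries.sum, FormalMultilinearSeries.ofScalars_apply_eq]
  rw [h3, ← h2.tsum_eq]
  simp [c]

end CharFun

/-! ### Analytic continuation of the moment generating function -/

section CharFun

open ProbabilityTheory Filter Topology
open scoped NNReal ENNReal

/-- Where exponential moments exist near `0`, an analytic generator of the characteristic function
also generates the moment generating function. -/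
lemma mgf_eventuallyEq_of_charFun {m : Measure ℝ} {ψ : ℝ → ℝ}
    (hchar : ∀ t : ℝ, charFun m t = (ψ (t ^ 2 / 2) : ℂ)) (hψ : AnalyticAt ℝ ψ 0)
    (h0 : 0 ∈ interior (integrableExpSet id m)) :
    mgf id m =ᶠ[𝓝 0] fun s => ψ (-s ^ 2 / 2) := by
  obtain ⟨F, hF, hFψ⟩ := exists_analyticAt_complex hψ
  have hH : AnalyticAt ℂ (complexMGF id m) 0 := analyticAt_complexMGF (by simpa using h0)
  have hF' : AnalyticAt ℂ (fun z : ℂ => F (-z ^ 2 / 2)) 0 := by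
    refine AnalyticAt.fun_comp (g := F) ?_ (by fun_prop)
    simpa using hF
  have htend : ∀ c : ℝ, Tendsto (fun t : ℝ => c * t ^ 2 / 2) (𝓝 0) (𝓝 0) := fun c => by
    have : Continuous fun t : ℝ => c * t ^ 2 / 2 := by fun_prop
    simpa using this.tendsto 0
  -- On the imaginary axis the complex moment generating function is the characteristic function, so
  -- the identity theorem carries the equality to the real axis.
  have hfreq : ∃ᶠ z in 𝓝[≠] (0 : ℂ), complexMGF id m z = F (-z ^ 2 / 2) := by
    have hI : Tendsto (fun t : ℝ => (t : ℂ) * Complex.I) (𝓝[≠] 0) (𝓝[≠] 0) := by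
      refine tendsto_nhdsWithin_of_tendsto_nhds_of_eventually_within _ ?_ ?_
      · have : Continuous fun t : ℝ => (t : ℂ) * Complex.I := by fun_prop
        exact (by simpa using this.tendsto 0 : Tendsto _ (𝓝 (0 : ℝ)) (𝓝 (0 : ℂ))).mono_left
          nhdsWithin_le_nhds
      · filter_upwards [self_mem_nhdsWithin] with t ht
        simpa using ht
    refine hI.frequently (Eventually.frequently ?_)
    filter_upwards [nhdsWithin_le_nhds ((htend 1).eventually hFψ)] with t ht
    rw [complexMGF_id_mul_I, hchar, one_mul] at *
    rw [← ht, mul_pow, Complex.I_sq]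
    congr 1
    push_cast
    ring
  have hev := (hH.frequently_eq_iff_eventually_eq hF').1 hfreq
  have hre : Tendsto (fun s : ℝ => (s : ℂ)) (𝓝 0) (𝓝 0) := by
    simpa using! Complex.continuous_ofReal.tendsto 0
  filter_upwards [hre.eventually hev, (htend (-1)).eventually hFψ] with s hs hs'
  rw [complexMGF_ofReal] at hs
  have h2 : (-(s : ℂ) ^ 2 / 2) = ((-1 * s ^ 2 / 2 : ℝ) : ℂ) := by
    push_cast
    ring
  rw [h2, hs'] at hs
  have := Complex.ofReal_injective hs
  rw [this]
  ring_nf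

/-- If the characteristic function of a law is `t ↦ ψ (t² / 2)` and `ψ` is analytic along
`(-∞, 0]`, then all exponential moments exist and the moment generating function is
`s ↦ ψ (-s² / 2)`. -/
theorem integrable_exp_and_mgf_of_charFun (m : Measure ℝ) [IsProbabilityMeasure m] {ψ : ℝ → ℝ}
    (hchar : ∀ t : ℝ, charFun m t = (ψ (t ^ 2 / 2) : ℂ)) (hψ : AnalyticOnNhd ℝ ψ (Set.Iic 0)) :
    (∀ s : ℝ, Integrable (fun x => Real.exp (s * x)) m) ∧ ∀ s : ℝ, mgf id m s = ψ (-s ^ 2 / 2) := by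
  let g : ℝ → ℝ := fun s => ψ (-s ^ 2 / 2)
  have hg : AnalyticOnNhd ℝ g Set.univ := fun s _ => by
    refine AnalyticAt.fun_comp (g := ψ) (hψ _ ?_) (by fun_prop)
    have := sq_nonneg s
    simp only [Set.mem_Iic]
    linarith
  have hψ0 : AnalyticAt ℝ ψ 0 := hψ 0 (by simp)
  have hφ : AnalyticAt ℝ (charFun m) 0 := by
    have h1 : AnalyticAt ℝ (fun t : ℝ => ψ (t ^ 2 / 2)) 0 := by
      refine AnalyticAt.fun_comp (g := ψ) ?_ (by fun_prop)
      simpa using hψ0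
    have h2 : charFun m = fun t : ℝ => Complex.ofRealCLM (ψ (t ^ 2 / 2)) := funext hchar
    rw [h2]
    exact (Complex.ofRealCLM.analyticAt _).fun_comp h1
  set I := interior (integrableExpSet id m)
  have hball : ∀ {s h : ℝ}, 0 < h → Integrable (fun x => Real.exp (s * x) * Real.cosh (h * x)) m →
      Set.Ioo (s - h) (s + h) ⊆ I := fun {s h} hh hi => by
    refine interior_maximal (fun t ht => integrable_exp_of_integrable_cosh hi ?_) isOpen_Ioo
    rw [abs_of_pos hh, abs_le]
    constructor <;> linarith [ht.1, ht.2]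
  have h0 : 0 ∈ I := by
    have heven := integrable_even_pow_of_analyticAt_charFun m hφ
    obtain ⟨p, r, hp⟩ := hφ
    obtain ⟨h, hh0, hhr⟩ := ENNReal.lt_iff_exists_nnreal_btwn.1 hp.r_pos
    have hh : (0 : ℝ) < h := by exact_mod_cast hh0
    have hi := integrable_mul_cosh (w := fun _ => 1) measurable_const (fun _ => zero_le_one) hp hhr
      (fun n => by simpa using heven n) (fun n => by
        simp only [one_mul]
        have hpos : ∀ x : ℝ, 0 ≤ x ^ (2 * n) := fun x => (even_two_mul n).pow_nonneg x
        rw [iteratedDeriv_charFun_zero (memLp_of_integrable_even_pow (heven n))]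
        simp only [norm_mul, norm_pow, Complex.norm_I, one_pow, one_mul]
        rw [← Complex.norm_of_nonneg (integral_nonneg hpos), ← integral_complex_ofReal]
        simp)
    refine hball (s := 0) hh (by simpa using hi) ⟨by linarith, by linarith⟩
  have hEq : Set.EqOn (mgf id m) g I :=
    (analyticOnNhd_mgf (X := id) (μ := m)).eqOn_of_preconnected_of_eventuallyEq
      (hg.mono (Set.subset_univ _))
      (convex_integrableExpSet.interior).isPreconnected h0
      (mgf_eventuallyEq_of_charFun hchar hψ0 h0)
  -- `I` is open and contains `0`; closedness makes it the whole line. Near a limit point `c`, the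
  -- Taylor series of `g` is recentred at some `s ∈ I` with `|s - c| < ρ/4`. It converges beyond
  -- radius `ρ/2`, and the resulting `cosh` moment covers `c`.
  have hclosed : IsClosed I := by
    refine isClosed_of_closure_subset fun c hc => ?_
    obtain ⟨p, r, hp⟩ := hg c trivial
    obtain ⟨ρ, hρ0, hρr⟩ := ENNReal.lt_iff_exists_nnreal_btwn.1 hp.r_pos
    have hρ : (0 : ℝ) < ρ := by exact_mod_cast hρ0
    have hp' := hp.mono hρ0 hρr.le
    obtain ⟨s, hs, hcs⟩ := Metric.mem_closure_iff.1 hc ((ρ : ℝ) / 4) (by positivity)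
    rw [dist_comm, Real.dist_eq] at hcs
    have hnn : ‖s - c‖₊ < ρ / 4 := by
      rw [← NNReal.coe_lt_coe]
      simpa using hcs
    have hq := hp'.changeOrigin (y := s - c) (by
      refine ENNReal.coe_lt_coe.2 (hnn.trans_le ?_)
      exact div_le_self zero_le (by norm_num))
    rw [add_sub_cancel] at hq
    have hlt : ((ρ / 2 : ℝ≥0) : ℝ≥0∞) < ρ - (‖s - c‖₊ : ℝ≥0∞) := by
      rw [← ENNReal.coe_sub, ENNReal.coe_lt_coe, lt_tsub_iff_right, ← NNReal.coe_lt_coe]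
      have : (‖s - c‖₊ : ℝ) < ρ / 4 := by simpa using hcs
      push_cast at this ⊢
      linarith
    have hi := integrable_mul_cosh (m := m) (w := fun x => Real.exp (s * x)) (by fun_prop)
      (fun _ => (Real.exp_pos _).le) hq hlt
      (fun n => by
        have := integrable_pow_mul_exp_of_mem_interior_integrableExpSet (X := id) hs (2 * n)
        simpa [mul_comm] using this)
      (fun n => by
        -- On `I` the derivatives of `g` are moments weighted by `exp (s x)`.
        have h1 : iteratedDeriv (2 * n) g s = iteratedDeriv (2 * n) (mgf id m) s :=
          ((hEq.symm.eventuallyEq_of_mem (isOpen_interior.mem_nhds hs)).iteratedDeriv_eq (2 * n))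
        rw [h1, iteratedDeriv_mgf hs]
        refine le_trans (le_of_eq ?_) (le_abs_self _)
        refine integral_congr_ae (ae_of_all _ fun x => ?_)
        simp [mul_comm])
    have hcs' := abs_lt.1 hcs
    refine hball (s := s) (h := (ρ / 2 : ℝ≥0)) (by push_cast; linarith) hi ?_
    push_cast
    constructor <;> linarith
  have huniv : I = Set.univ :=
    IsClopen.eq_univ ⟨hclosed, isOpen_interior⟩ ⟨0, h0⟩
  refine ⟨fun s => ?_, fun s => hEq (by rw [huniv]; trivial)⟩
  have : s ∈ I := by rw [huniv]; trivial
  have hmem := interior_subset this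
  exact hmem

end CharFun

/-! ### Linear images of elliptical laws -/

section Elliptical

open ProbabilityTheory

variable {ι : Type*} [Fintype ι] {P : Measure (ι → ℝ)} {Z : Measure ℝ} {μ : ι → ℝ}
  {Sg : Matrix ι ι ℝ} {ψ : ℝ → ℝ} {τ : ι → ℝ}

lemma measurable_dotProduct (τ : ι → ℝ) : Measurable fun r => τ ⬝ᵥ r := by
  unfold dotProduct
  fun_prop

lemma volume_hyperplane (hτ : τ ≠ 0) (c : ℝ) : volume {r : ι → ℝ | τ ⬝ᵥ r = c} = 0 := by
  classical
  rcases Set.eq_empty_or_nonempty {r : ι → ℝ | τ ⬝ᵥ r = c} with h | ⟨r₀, hr₀⟩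
  · rw [h, measure_empty]
  · let L : (ι → ℝ) →ₗ[ℝ] ℝ := dotProductBilin ℝ ℝ τ
    have hL : ∀ r, L r = τ ⬝ᵥ r := fun r => rfl
    have hset : {r : ι → ℝ | τ ⬝ᵥ r = c} = (fun r => r + -r₀) ⁻¹' (LinearMap.ker L : Set (ι → ℝ)) := by
      ext r
      have : τ ⬝ᵥ r₀ = c := hr₀
      simp [hL, ← sub_eq_add_neg, sub_eq_zero, this]
    rw [hset, measure_preimage_add_right]
    refine Measure.addHaar_submodule _ _ fun h => hτ ?_
    have h0 : L = 0 := LinearMap.ker_eq_top.1 h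
    refine dotProduct_eq_zero τ fun w => ?_
    rw [← hL, h0]
    rfl

/-- A linear image of an elliptical law is an affine image of the standard law. -/
lemma IsElliptical.map_dotProduct (hP : IsElliptical P μ Sg ψ) (hZ : IsStdElliptical Z ψ)
    (τ : ι → ℝ) : P.map (fun r => τ ⬝ᵥ r)
      = Z.map fun z => τ ⬝ᵥ μ + Real.sqrt (τ ⬝ᵥ (Sg *ᵥ τ)) * z := by
  have := hP.isProb
  have := hZ.isProb
  set σ := Real.sqrt (τ ⬝ᵥ (Sg *ᵥ τ))
  have hσ : σ ^ 2 = τ ⬝ᵥ (Sg *ᵥ τ) := Real.sq_sqrt (by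
    simpa using hP.posSemidef.dotProduct_mulVec_nonneg τ)
  have hm := measurable_dotProduct τ
  refine Measure.ext_of_charFun (funext fun t => ?_)
  have hcomp : (Z.map fun z => τ ⬝ᵥ μ + σ * z) = (Z.map fun z => σ * z).map fun z => τ ⬝ᵥ μ + z := by
    rw [Measure.map_map (by fun_prop) (by fun_prop)]
    rfl
  rw [hcomp, charFun_map_const_add, charFun_map_mul, hZ.charFun_eq, charFun_apply_real,
    integral_map (f := fun x : ℝ => Complex.exp (t * x * Complex.I)) hm.aemeasurable (by fun_prop)]
  have h := hP.charFun_eq (t • τ)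
  have h1 : (t • τ) ⬝ᵥ (Sg *ᵥ (t • τ)) / 2 = (σ * t) ^ 2 / 2 := by
    rw [mul_pow, hσ, mulVec_smul, smul_dotProduct, dotProduct_smul, smul_eq_mul, smul_eq_mul]
    ring
  have h2 : inner ℝ (τ ⬝ᵥ μ) t = t * (τ ⬝ᵥ μ) := rfl
  rw [h1] at h
  simp only [smul_dotProduct, smul_eq_mul] at h
  rw [h2, mul_comm _ Complex.I, mul_comm _ (Complex.exp _), ← h]
  refine integral_congr_ae (ae_of_all _ fun x => ?_)
  simp only
  congr 1
  push_cast
  ring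

/-- With zero dispersion the image would be a point mass, and `P` would charge a hyperplane. A
density thus replaces definiteness of `Sg`. -/
lemma IsElliptical.sqrt_pos (hP : IsElliptical P μ Sg ψ) (hZ : IsStdElliptical Z ψ)
    (hac : P ≪ volume) (hτ : τ ≠ 0) : 0 < Real.sqrt (τ ⬝ᵥ (Sg *ᵥ τ)) := by
  have := hZ.isProb
  refine lt_of_le_of_ne (Real.sqrt_nonneg _) fun h => ?_
  have h1 := hP.map_dotProduct hZ τ
  rw [← h] at h1
  have h2 := congrArg (fun m => m {τ ⬝ᵥ μ}) h1
  simp only [zero_mul, add_zero] at h2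
  rw [Measure.map_apply (measurable_dotProduct τ) (measurableSet_singleton _),
    Measure.map_apply measurable_const (measurableSet_singleton _)] at h2
  have h3 := hac (volume_hyperplane hτ (τ ⬝ᵥ μ))
  have h4 : (fun r => τ ⬝ᵥ r) ⁻¹' {τ ⬝ᵥ μ} = {r | τ ⬝ᵥ r = τ ⬝ᵥ μ} := rfl
  rw [h4, h3] at h2
  simp at h2

lemma IsElliptical.std_measure_singleton (hP : IsElliptical P μ Sg ψ) (hZ : IsStdElliptical Z ψ)
    (hac : P ≪ volume) (hτ : τ ≠ 0) (c : ℝ) : Z {c} = 0 := by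
  have hσ := hP.sqrt_pos hZ hac hτ
  have h1 := congrArg (fun m => m {τ ⬝ᵥ μ + Real.sqrt (τ ⬝ᵥ (Sg *ᵥ τ)) * c})
    (hP.map_dotProduct hZ τ)
  rw [Measure.map_apply (measurable_dotProduct τ) (measurableSet_singleton _),
    Measure.map_apply (by fun_prop) (measurableSet_singleton _)] at h1
  refine (congrArg Z ?_).trans (h1.symm.trans (hac (volume_hyperplane hτ _)))
  ext z
  simp [hσ.ne']

/-- The constraint on a single component says that `l` is at most the probability that the
constraint holds under this component. -/
lemma IsElliptical.component_iff (hP : IsElliptical P μ Sg ψ) (hZ : IsStdElliptical Z ψ)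
    (hac : P ≪ volume) (hτ : τ ≠ 0) (ξ l : ℝ) :
    (ξ : EReal) ≤ ((τ ⬝ᵥ μ : ℝ) : EReal) + cdfInv Z (1 - l)
      * ((Real.sqrt (τ ⬝ᵥ (Sg *ᵥ τ)) : ℝ) : EReal) ↔ l ≤ P.real {r | ξ ≤ τ ⬝ᵥ r} := by
  have := hZ.isProb
  have hσ := hP.sqrt_pos hZ hac hτ
  have hatom := hP.std_measure_singleton hZ hac hτ
  rw [coe_le_add_cdfInv_mul_iff Z hatom hσ]
  set σ := Real.sqrt (τ ⬝ᵥ (Sg *ᵥ τ))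
  set c := (ξ - τ ⬝ᵥ μ) / σ
  have h1 : P.real {r | ξ ≤ τ ⬝ᵥ r} = 1 - cdf Z c := by
    have h2 : P {r | ξ ≤ τ ⬝ᵥ r} = Z (Set.Ici c) := by
      have h := congrArg (fun m => m (Set.Ici ξ)) (hP.map_dotProduct hZ τ)
      rw [Measure.map_apply (measurable_dotProduct τ) measurableSet_Ici,
        Measure.map_apply (by fun_prop) measurableSet_Ici] at h
      refine h.trans (congrArg Z ?_)
      ext z
      simp only [Set.mem_preimage, Set.mem_Ici, c]
      rw [div_le_iff₀ hσ, sub_le_iff_le_add', mul_comm]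
    have : NullSingletonClass Z := ⟨hatom⟩
    have h3 : Z.real (Set.Ici c) = Z.real (Set.Ioi c) := measureReal_congr Ioi_ae_eq_Ici.symm
    rw [measureReal_def, h2, ← measureReal_def, h3, cdf_eq_real, ← Set.compl_Iic,
      probReal_compl_eq_one_sub measurableSet_Iic]
  rw [h1]
  constructor <;> intro h <;> linarith

lemma IsElliptical.integrable_exp (hP : IsElliptical P μ Sg ψ) (hZ : IsStdElliptical Z ψ)
    (hψ : AnalyticOnNhd ℝ ψ (Set.Iic 0)) (τ : ι → ℝ) (s : ℝ) :
    Integrable (fun r => Real.exp (s * -(τ ⬝ᵥ r))) P := by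
  have := hZ.isProb
  have h := (integrable_exp_and_mgf_of_charFun Z hZ.charFun_eq hψ).1
    (-s * Real.sqrt (τ ⬝ᵥ (Sg *ᵥ τ)))
  have h1 : Integrable (fun y => Real.exp (s * -y)) (P.map fun r => τ ⬝ᵥ r) := by
    rw [hP.map_dotProduct hZ τ, integrable_map_measure (by fun_prop) (by fun_prop)]
    refine (h.const_mul (Real.exp (-s * (τ ⬝ᵥ μ)))).congr (ae_of_all _ fun z => ?_)
    simp only [Function.comp]
    rw [← Real.exp_add]
    ring_nf
  exact (integrable_map_measure (by fun_prop) (measurable_dotProduct τ).aemeasurable).1 h1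

lemma IsElliptical.integral_exp (hP : IsElliptical P μ Sg ψ) (hZ : IsStdElliptical Z ψ)
    (hψ : AnalyticOnNhd ℝ ψ (Set.Iic 0)) (τ : ι → ℝ) (s : ℝ) :
    ∫ r, Real.exp (s * -(τ ⬝ᵥ r)) ∂P
      = Real.exp (-s * (τ ⬝ᵥ μ)) * ψ (-(s ^ 2 * (τ ⬝ᵥ (Sg *ᵥ τ))) / 2) := by
  have := hZ.isProb
  set σ := Real.sqrt (τ ⬝ᵥ (Sg *ᵥ τ))
  have hσ : σ ^ 2 = τ ⬝ᵥ (Sg *ᵥ τ) := Real.sq_sqrt (by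
    simpa using hP.posSemidef.dotProduct_mulVec_nonneg τ)
  have h := (integrable_exp_and_mgf_of_charFun Z hZ.charFun_eq hψ).2 (-s * σ)
  have h1 : ∫ r, Real.exp (s * -(τ ⬝ᵥ r)) ∂P
      = ∫ y, Real.exp (s * -y) ∂(P.map fun r => τ ⬝ᵥ r) :=
    (integral_map (f := fun y => Real.exp (s * -y)) (measurable_dotProduct τ).aemeasurable (by fun_prop)).symm
  have hmap : P.map (fun r => τ ⬝ᵥ r) = Z.map fun z => τ ⬝ᵥ μ + σ * z := hP.map_dotProduct hZ τ
  rw [h1, hmap, integral_map (by fun_prop) (by fun_prop), ← hσ]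
  have h2 : -(s ^ 2 * σ ^ 2) / 2 = -(-s * σ) ^ 2 / 2 := by ring
  rw [h2, ← h, mgf, ← integral_const_mul]
  refine integral_congr_ae (ae_of_all _ fun z => ?_)
  simp only [id]
  rw [← Real.exp_add]
  ring_nf

end Elliptical

/-! ### Finite mixtures -/

section Mixture

variable {ι : Type*} {J : ℕ} {ω : Fin J → ℝ} {P : Fin J → Measure (ι → ℝ)}

lemma isProbabilityMeasure_mixture (hω : ∀ j, 0 ≤ ω j) (hω1 : ∑ j, ω j = 1)
    (hP : ∀ j, IsProbabilityMeasure (P j)) : IsProbabilityMeasure (mixture ω P) := by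
  refine ⟨?_⟩
  simp only [mixture, Measure.finsetSum_apply, Measure.smul_apply, measure_univ, smul_eq_mul,
    mul_one]
  rw [← ENNReal.ofReal_sum_of_nonneg fun j _ => hω j, hω1, ENNReal.ofReal_one]

lemma mixture_real_apply (hω : ∀ j, 0 ≤ ω j) (hP : ∀ j, IsProbabilityMeasure (P j))
    (E : Set (ι → ℝ)) : (mixture ω P).real E = ∑ j, ω j * (P j).real E := by
  simp only [mixture, measureReal_def, Measure.finsetSum_apply, Measure.smul_apply, smul_eq_mul]
  rw [ENNReal.toReal_sum fun j _ => ENNReal.mul_ne_top ENNReal.ofReal_ne_top (measure_ne_top _ _)]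
  simp [ENNReal.toReal_ofReal (hω _)]

lemma mixture_apply_eq_zero {E : Set (ι → ℝ)} (h : ∀ j, P j E = 0) : mixture ω P E = 0 := by
  simp [mixture, h]

lemma integrable_mixture {f : (ι → ℝ) → ℝ} (h : ∀ j, Integrable f (P j)) :
    Integrable f (mixture ω P) := by
  rw [mixture, integrable_finsetSum_measure]
  exact fun j _ => (h j).smul_measure ENNReal.ofReal_ne_top

lemma integral_mixture (hω : ∀ j, 0 ≤ ω j) {f : (ι → ℝ) → ℝ} (h : ∀ j, Integrable f (P j)) :
    ∫ r, f r ∂(mixture ω P) = ∑ j, ω j * ∫ r, f r ∂(P j) := by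
  rw [mixture, integral_finsetSum_measure fun j _ => (h j).smul_measure ENNReal.ofReal_ne_top]
  simp [integral_smul_measure, ENNReal.toReal_ofReal (hω _)]

end Mixture

/-- A zero `τ` would force `q = 0`. Nonzero `τ` makes the level sets of `τᵀr` null hyperplanes. -/
lemma MDP.ne_zero_of_mem_occ {S : Type*} {A : S → Type*} [Fintype S] [DecidableEq S]
    [∀ s, Fintype (A s)] (M : MDP S A) {τ : (Σ s, A s) → ℝ} (hτ : τ ∈ M.occ) : τ ≠ 0 := by
  rintro rfl
  have h : ∀ s, M.q s = 0 := fun s => by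
    have h1 := hτ.1 s
    simp only [Pi.zero_apply, zero_mul, Finset.sum_const_zero] at h1
    exact (mul_eq_zero.1 h1.symm).resolve_left (sub_pos.2 M.β_lt_one).ne'
  have := M.q_sum
  simp [h] at this

/-! ### Duality for the robust objective -/

section Objective

open ProbabilityTheory InformationTheory Filter Topology

variable {ι : Type*} [Fintype ι] {J : ℕ} {ω : Fin J → ℝ} {μ : Fin J → ι → ℝ}
  {Sg : Fin J → Matrix ι ι ℝ} {ψ : Fin J → ℝ → ℝ} {P : Fin J → Measure (ι → ℝ)}
  {Z : Fin J → Measure ℝ} {δ : ℝ}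

lemma integrable_exp_mixture (hP : ∀ j, IsElliptical (P j) (μ j) (Sg j) (ψ j))
    (hZ : ∀ j, IsStdElliptical (Z j) (ψ j)) (hψ : ∀ j, AnalyticOnNhd ℝ (ψ j) (Set.Iic 0))
    (τ : ι → ℝ) (s : ℝ) : Integrable (fun r => Real.exp (s * -(τ ⬝ᵥ r))) (mixture ω P) :=
  integrable_mixture fun j => (hP j).integrable_exp (hZ j) (hψ j) τ s

lemma integrable_dotProduct_of_mem_klBall (hω : ∀ j, 0 ≤ ω j) (hω1 : ∑ j, ω j = 1)
    (hP : ∀ j, IsElliptical (P j) (μ j) (Sg j) (ψ j)) (hZ : ∀ j, IsStdElliptical (Z j) (ψ j))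
    (hψ : ∀ j, AnalyticOnNhd ℝ (ψ j) (Set.Iic 0)) {F : Measure (ι → ℝ)}
    (hF : F ∈ klBall (mixture ω P) δ) (τ : ι → ℝ) : Integrable (fun r => τ ⬝ᵥ r) F := by
  have := isProbabilityMeasure_mixture hω hω1 fun j => (hP j).isProb
  have := hF.1
  have h := integrable_of_klDiv_le_of_exp (Y := fun r => -(τ ⬝ᵥ r)) (measurable_dotProduct τ).neg
    (integrable_exp_mixture hP hZ hψ τ) hF.2
  exact h.neg.congr (ae_of_all _ fun r => by simp)

/-- The objective of the explicit problem is the dual bound on a Kullback-Leibler ball. -/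
lemma objectiveFormula_eq (hω : ∀ j, 0 ≤ ω j)
    (hP : ∀ j, IsElliptical (P j) (μ j) (Sg j) (ψ j)) (hZ : ∀ j, IsStdElliptical (Z j) (ψ j))
    (hψ : ∀ j, AnalyticOnNhd ℝ (ψ j) (Set.Iic 0)) (τ : ι → ℝ) {α : ℝ} (hα : 0 < α) :
    objectiveFormula ω μ Sg ψ δ τ α
      = (δ + cgf (fun r => -(τ ⬝ᵥ r)) (mixture ω P) α⁻¹) / α⁻¹ := by
  rw [cgf, mgf, integral_mixture hω fun j => (hP j).integrable_exp (hZ j) (hψ j) τ _,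
    objectiveFormula, div_inv_eq_mul, add_mul, mul_comm δ, add_comm, mul_comm (Real.log _)]
  congr 3
  refine Finset.sum_congr rfl fun j _ => ?_
  rw [(hP j).integral_exp (hZ j) (hψ j), mul_assoc]
  congr 3
  · ring
  · field_simp

/-- Strong duality for the robust objective, with a positive optimal multiplier. -/
lemma exists_robustObjective_eq (hω : ∀ j, 0 ≤ ω j) (hω1 : ∑ j, ω j = 1)
    (hP : ∀ j, IsElliptical (P j) (μ j) (Sg j) (ψ j)) (hdens : ∀ j, P j ≪ volume)
    (hZ : ∀ j, IsStdElliptical (Z j) (ψ j)) (hψ : ∀ j, AnalyticOnNhd ℝ (ψ j) (Set.Iic 0))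
    (hδ : 0 < δ) {β : ℝ} (hβ : β < 1) {τ : ι → ℝ} (hτ : τ ≠ 0) :
    ∃ α : ℝ, 0 < α ∧
      (∀ α' : ℝ, 0 < α' → objectiveFormula ω μ Sg ψ δ τ α ≤ objectiveFormula ω μ Sg ψ δ τ α') ∧
      robustObjective β (mixture ω P) δ τ
        = -(((1 / (1 - β) : ℝ) : EReal) * (objectiveFormula ω μ Sg ψ δ τ α : EReal)) := by
  have hprob := isProbabilityMeasure_mixture hω hω1 fun j => (hP j).isProb
  have hexp := integrable_exp_mixture (ω := ω) hP hZ hψ τ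
  have hY : Measurable fun r => -(τ ⬝ᵥ r) := (measurable_dotProduct τ).neg
  have hatom : ∀ c, mixture ω P {r | -(τ ⬝ᵥ r) = c} = 0 := fun c =>
    mixture_apply_eq_zero fun j => by
      simp only [neg_eq_iff_eq_neg]
      exact hdens j (volume_hyperplane hτ (-c))
  obtain ⟨s, hs, G, hGP, hG, hGY⟩ := exists_tilted_klDiv_eq hY hexp hatom hδ
  have hupper : ∀ F ∈ klBall (mixture ω P) δ, ∀ α : ℝ, 0 < α →
      ∫ r, -(τ ⬝ᵥ r) ∂F ≤ objectiveFormula ω μ Sg ψ δ τ α := fun F hF α hα => by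
    have := hF.1
    rw [objectiveFormula_eq hω hP hZ hψ τ hα]
    exact integral_le_of_klDiv_le_of_exp hY hexp hδ.le hF.2 (inv_pos.2 hα)
  have hGα : ∫ r, -(τ ⬝ᵥ r) ∂G = objectiveFormula ω μ Sg ψ δ τ s⁻¹ := by
    rw [objectiveFormula_eq hω hP hZ hψ τ (inv_pos.2 hs), inv_inv, hGY]
  have hc : 0 ≤ 1 / (1 - β) := by
    have := sub_pos.2 hβ
    positivity
  -- The single law `G` proves both claims: its mean equals the dual value at `s⁻¹` and lies below
  -- every other dual value.
  refine ⟨s⁻¹, inv_pos.2 hs, fun α hα => hGα ▸ hupper G ⟨hGP, hG⟩ α hα, ?_⟩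
  rw [← EReal.coe_mul, ← EReal.coe_neg]
  refine le_antisymm ((iInf₂_le G ⟨hGP, hG⟩).trans (le_of_eq ?_))
    (le_iInf₂ fun F hF => EReal.coe_le_coe_iff.2 ?_)
  · rw [← hGα, integral_neg]
    congr 1
    ring
  · have h := mul_le_mul_of_nonneg_left (hupper F hF s⁻¹ (inv_pos.2 hs)) hc
    rw [integral_neg] at h
    linarith

lemma explicitObjective_of_pos {τ : ι → ℝ} {α : ℝ} (hα : 0 < α) :
    explicitObjective ω μ Sg ψ δ τ α = (objectiveFormula ω μ Sg ψ δ τ α : EReal) :=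
  if_neg hα.ne'

/-- A lower bound over `α > 0` survives the limit, so `α = 0` cannot beat a positive minimiser. -/
lemma le_explicitObjective {τ : ι → ℝ} {c : EReal}
    (h : ∀ α : ℝ, 0 < α → c ≤ (objectiveFormula ω μ Sg ψ δ τ α : EReal)) {α : ℝ} (hα : 0 ≤ α) :
    c ≤ explicitObjective ω μ Sg ψ δ τ α := by
  rcases hα.eq_or_lt with rfl | hα
  · rw [explicitObjective, if_pos rfl]
    refine le_liminf_of_le (by isBoundedDefault) ?_
    filter_upwards [self_mem_nhdsWithin] with a ha using h a ha
  · rw [explicitObjective_of_pos hα]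
    exact h α hα

end Objective

/-! ### Feasibility in the explicit problem -/

section Feasible

variable {ι : Type*} [Fintype ι] {K : ℕ} {J : Fin (K + 1) → ℕ}
  {ω : (k : Fin (K + 1)) → Fin (J k) → ℝ} {μ : (k : Fin (K + 1)) → Fin (J k) → ι → ℝ}
  {Sg : (k : Fin (K + 1)) → Fin (J k) → Matrix ι ι ℝ} {ψ : (k : Fin (K + 1)) → Fin (J k) → ℝ → ℝ}
  {P : (k : Fin (K + 1)) → Fin (J k) → Measure (ι → ℝ)}
  {Z : (k : Fin (K + 1)) → Fin (J k) → Measure ℝ} {δ : Fin (K + 1) → ℝ} {ξ : Fin K → ℝ} {ε : ℝ}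
  {Δ : Set (ι → ℝ)}

lemma IsExplicitFeasible.with_α {v : Var ι K J}
    (h : IsExplicitFeasible Δ ω μ Sg Z δ ξ ε v) {α : ℝ} (hα : 0 ≤ α) :
    IsExplicitFeasible Δ ω μ Sg Z δ ξ ε { v with α := α } :=
  ⟨h.component, h.weight, h.link, h.x_mem, h.y_mem, h.yhat_mem, h.l_mem, h.confidence, hα, h.τ_mem⟩

/-- The component constraints bound each `l` by a reference probability, so nothing is lost by
choosing `l` and `yhat` as the exact component and mixture probabilities. -/
lemma mem_robustFeasible_iff_exists (hδ : ∀ k, 0 < δ k) (hε : 0 < ε) (hω : ∀ k j, 0 ≤ ω k j)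
    (hω1 : ∀ k, ∑ j, ω k j = 1) (hP : ∀ k j, IsElliptical (P k j) (μ k j) (Sg k j) (ψ k j))
    (hdens : ∀ k j, P k j ≪ volume) (hZ : ∀ k j, IsStdElliptical (Z k j) (ψ k j))
    (hΔ : ∀ τ ∈ Δ, τ ≠ 0)
    (hlt : ∀ k : Fin K, ∀ τ ∈ Δ, mixture (ω k.succ) (P k.succ) {r | ξ k ≤ τ ⬝ᵥ r} < 1)
    (τ : ι → ℝ) :
    τ ∈ robustFeasible Δ (fun k : Fin K => mixture (ω k.succ) (P k.succ))
        (fun k => δ k.succ) ξ ε ↔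
      ∃ v ∈ {v : Var ι K J | IsExplicitFeasible Δ ω μ Sg Z δ ξ ε v}, v.τ = τ := by
  have hPp : ∀ k j, IsProbabilityMeasure (P k j) := fun k j => (hP k j).isProb
  have hprob : ∀ k : Fin K, IsProbabilityMeasure (mixture (ω k.succ) (P k.succ)) := fun k =>
    isProbabilityMeasure_mixture (hω _) (hω1 _) (hPp _)
  have hreal : ∀ (k : Fin K) (τ : ι → ℝ),
      (mixture (ω k.succ) (P k.succ)).real {r | ξ k ≤ τ ⬝ᵥ r}
        = ∑ j, ω k.succ j * (P k.succ j).real {r | ξ k ≤ τ ⬝ᵥ r} := fun k τ =>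
    mixture_real_apply (hω _) (hPp _) _
  constructor
  · intro h
    have hτΔ : τ ∈ Δ := h.1
    obtain ⟨-, x, y, hx, hy, hxy, hprod⟩ := (mem_robustFeasible_iff Δ _ _ ξ ε
      (fun k => hδ k.succ) hε (fun k => hlt k τ hτΔ)).1 h
    refine ⟨⟨τ, 0, x, y, fun k j => (P k.succ j).real {r | ξ k ≤ τ ⬝ᵥ r},
      fun k => (mixture (ω k.succ) (P k.succ)).real {r | ξ k ≤ τ ⬝ᵥ r}⟩, ?_, rfl⟩
    exact
      { component := fun k j => ((hP k.succ j).component_iff (hZ k.succ j) (hdens k.succ j)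
          (hΔ τ hτΔ) (ξ k) _).2 le_rfl
        weight := fun k => (hreal k τ).le
        link := hxy
        x_mem := hx
        y_mem := hy
        yhat_mem := fun k => ⟨measureReal_nonneg, measureReal_le_one⟩
        l_mem := fun k j => ⟨measureReal_nonneg, measureReal_le_one⟩
        confidence := hprod
        α_nonneg := le_rfl
        τ_mem := hτΔ }
  · rintro ⟨v, hv, rfl⟩
    have hv : IsExplicitFeasible Δ ω μ Sg Z δ ξ ε v := hv
    refine (mem_robustFeasible_iff Δ _ _ ξ ε (fun k => hδ k.succ) hε
      (fun k => hlt k v.τ hv.τ_mem)).2 ⟨hv.τ_mem, v.x, v.y, hv.x_mem, hv.y_mem, fun k => ?_,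
      hv.confidence⟩
    refine (hv.link k).trans ((hv.weight k).trans ?_)
    rw [hreal]
    exact Finset.sum_le_sum fun j _ => mul_le_mul_of_nonneg_left
      (((hP k.succ j).component_iff (hZ k.succ j) (hdens k.succ j) (hΔ _ hv.τ_mem) (ξ k) _).1
        (hv.component k j)) (hω _ _)

end Feasible

/-! ### Transfer of optimal values and solutions -/

section Equivalence

lemma neg_coe_mul_le_neg_coe_mul_iff {c : ℝ} (hc : 0 < c) {a b : EReal} :
    -((c : EReal) * a) ≤ -((c : EReal) * b) ↔ b ≤ a := by
  rw [EReal.neg_le_neg_iff]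
  refine ⟨fun h => ?_, fun h => mul_le_mul_of_nonneg_left h (by exact_mod_cast hc.le)⟩
  have hc' : (0 : EReal) ≤ ((c⁻¹ : ℝ) : EReal) := by exact_mod_cast (inv_pos.2 hc).le
  have h1 := mul_le_mul_of_nonneg_left h hc'
  rwa [← mul_assoc, ← mul_assoc, ← EReal.coe_mul, inv_mul_cancel₀ hc.ne', EReal.coe_one, one_mul,
    one_mul] at h1

lemma exists_neg_coe_mul_eq {c : ℝ} (hc : 0 < c) (z : EReal) : ∃ w : EReal, z = -((c : EReal) * w) := by
  refine ⟨-(((c⁻¹ : ℝ) : EReal) * z), ?_⟩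
  rw [mul_neg, neg_neg, ← mul_assoc, ← EReal.coe_mul, mul_inv_cancel₀ hc.ne', EReal.coe_one,
    one_mul]

end Equivalence

end DRCCMDP

theorem mainTheorem4 {S : Type*} {A : S → Type*} [Fintype S] [DecidableEq S]
    [∀ s, Fintype (A s)] (M : DRCCMDP.MDP S A)
    {K : ℕ} (J : Fin (K + 1) → ℕ)
    (ω : (k : Fin (K + 1)) → Fin (J k) → ℝ)
    (μ : (k : Fin (K + 1)) → Fin (J k) → (Σ s, A s) → ℝ)
    (Sg : (k : Fin (K + 1)) → Fin (J k) → Matrix (Σ s, A s) (Σ s, A s) ℝ)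
    (ψ : (k : Fin (K + 1)) → Fin (J k) → ℝ → ℝ)
    (P : (k : Fin (K + 1)) → Fin (J k) → MeasureTheory.Measure ((Σ s, A s) → ℝ))
    (Z : (k : Fin (K + 1)) → Fin (J k) → MeasureTheory.Measure ℝ)
    (δ : Fin (K + 1) → ℝ) (ξ : Fin K → ℝ) (ε : ℝ)
    -- radii and confidence level
    (hδ : ∀ k, 0 < δ k) (hε0 : 0 < ε) (hε1 : ε ≤ 1)
    -- mixture weights
    (hω : ∀ k j, 0 ≤ ω k j) (hω1 : ∀ k, ∑ j, ω k j = 1)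
    -- the components are elliptical laws with densities; `Z k j` has law `E_1(0, 1, ψ k j)`
    (hP : ∀ k j, DRCCMDP.IsElliptical (P k j) (μ k j) (Sg k j) (ψ k j))
    (hdens : ∀ k j, (P k j).AbsolutelyContinuous MeasureTheory.volume)
    (hZ : ∀ k j, DRCCMDP.IsStdElliptical (Z k j) (ψ k j))
    -- assumptions on the components of the reference law of the objective
    (hSg0 : ∀ j, (Sg 0 j).PosDef) (hμ0 : ∀ j e, μ 0 j e ≤ 0)
    (hψcont : ∀ j, Continuous (ψ 0 j))
    (hψan : ∀ j, AnalyticOnNhd ℝ (ψ 0 j) (Set.Iic 0))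
    (hψinf : ∀ j, ∀ t ≤ 0, Real.exp (-δ 0) ≤ ψ 0 j t)
    -- no constraint holds almost surely under its reference law
    (hlt : ∀ k : Fin K, ∀ τ ∈ M.occ,
      DRCCMDP.mixture (ω k.succ) (P k.succ) {r | ξ k ≤ dotProduct τ r} < 1) :
    -- all expectations in the robust objective exist
    (∀ τ, ∀ F ∈ DRCCMDP.klBall (DRCCMDP.mixture (ω 0) (P 0)) (δ 0),
      MeasureTheory.Integrable (fun r => dotProduct τ r) F) ∧
    -- the feasible occupation measures are the same
    (∀ τ, τ ∈ DRCCMDP.robustFeasible M.occ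
      (fun k : Fin K => DRCCMDP.mixture (ω k.succ) (P k.succ)) (fun k => δ k.succ) ξ ε ↔
      ∃ v ∈ {v : DRCCMDP.Var (Σ s, A s) K J | DRCCMDP.IsExplicitFeasible M.occ ω μ Sg Z δ ξ ε v},
        v.τ = τ) ∧
    -- for fixed `τ` the two objectives agree, and the minimum over `α ≥ 0` is attained
    (∀ τ ∈ M.occ, ∃ α : ℝ, 0 ≤ α ∧
      (∀ α' : ℝ, 0 ≤ α' →
        DRCCMDP.explicitObjective (ω 0) (μ 0) (Sg 0) (ψ 0) (δ 0) τ α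
          ≤ DRCCMDP.explicitObjective (ω 0) (μ 0) (Sg 0) (ψ 0) (δ 0) τ α') ∧
      DRCCMDP.robustObjective M.β (DRCCMDP.mixture (ω 0) (P 0)) (δ 0) τ
        = -(((1 / (1 - M.β) : ℝ) : EReal)
            * DRCCMDP.explicitObjective (ω 0) (μ 0) (Sg 0) (ψ 0) (δ 0) τ α)) ∧
    -- the optimal values agree
    (⨆ τ ∈ DRCCMDP.robustFeasible M.occ
      (fun k : Fin K => DRCCMDP.mixture (ω k.succ) (P k.succ)) (fun k => δ k.succ) ξ ε,
        DRCCMDP.robustObjective M.β (DRCCMDP.mixture (ω 0) (P 0)) (δ 0) τ)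
      = -(((1 / (1 - M.β) : ℝ) : EReal)
          * ⨅ v ∈ {v : DRCCMDP.Var (Σ s, A s) K J | DRCCMDP.IsExplicitFeasible M.occ ω μ Sg Z δ ξ ε v},
              DRCCMDP.explicitObjective (ω 0) (μ 0) (Sg 0) (ψ 0) (δ 0) v.τ v.α) ∧
    -- the optimal solutions correspond
    (∀ τ, (τ ∈ DRCCMDP.robustFeasible M.occ
      (fun k : Fin K => DRCCMDP.mixture (ω k.succ) (P k.succ)) (fun k => δ k.succ) ξ ε ∧
        IsMaxOn (DRCCMDP.robustObjective M.β (DRCCMDP.mixture (ω 0) (P 0)) (δ 0))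
          (DRCCMDP.robustFeasible M.occ
      (fun k : Fin K => DRCCMDP.mixture (ω k.succ) (P k.succ)) (fun k => δ k.succ) ξ ε) τ) ↔
      ∃ v ∈ {v : DRCCMDP.Var (Σ s, A s) K J | DRCCMDP.IsExplicitFeasible M.occ ω μ Sg Z δ ξ ε v},
        IsMinOn (fun w : DRCCMDP.Var (Σ s, A s) K J =>
            DRCCMDP.explicitObjective (ω 0) (μ 0) (Sg 0) (ψ 0) (δ 0) w.τ w.α)
          {v : DRCCMDP.Var (Σ s, A s) K J | DRCCMDP.IsExplicitFeasible M.occ ω μ Sg Z δ ξ ε v} v ∧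
        v.τ = τ) := by
  have hc : 0 < 1 / (1 - M.β) := one_div_pos.2 (sub_pos.2 M.β_lt_one)
  have hfeas := DRCCMDP.mem_robustFeasible_iff_exists (Δ := M.occ) (ξ := ξ) hδ hε0 hω hω1 hP hdens
    hZ (fun τ => M.ne_zero_of_mem_occ) hlt
  have hmin : ∀ τ ∈ M.occ, ∃ α : ℝ, 0 ≤ α ∧
      (∀ α' : ℝ, 0 ≤ α' →
        DRCCMDP.explicitObjective (ω 0) (μ 0) (Sg 0) (ψ 0) (δ 0) τ α
          ≤ DRCCMDP.explicitObjective (ω 0) (μ 0) (Sg 0) (ψ 0) (δ 0) τ α') ∧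
      DRCCMDP.robustObjective M.β (DRCCMDP.mixture (ω 0) (P 0)) (δ 0) τ
        = -(((1 / (1 - M.β) : ℝ) : EReal)
            * DRCCMDP.explicitObjective (ω 0) (μ 0) (Sg 0) (ψ 0) (δ 0) τ α) := by
    intro τ hτ
    obtain ⟨α, hα, hαmin, hobj⟩ := DRCCMDP.exists_robustObjective_eq (hω 0) (hω1 0) (hP 0)
      (hdens 0) (hZ 0) hψan (hδ 0) M.β_lt_one (M.ne_zero_of_mem_occ hτ)
    refine ⟨α, hα.le, fun α' hα' => ?_, ?_⟩
    · rw [DRCCMDP.explicitObjective_of_pos hα]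
      exact DRCCMDP.le_explicitObjective (fun a ha => EReal.coe_le_coe_iff.2 (hαmin a ha)) hα'
    · rw [DRCCMDP.explicitObjective_of_pos hα, hobj]
  refine ⟨fun τ F hF => DRCCMDP.integrable_dotProduct_of_mem_klBall (hω 0) (hω1 0) (hP 0) (hZ 0)
    hψan hF τ, hfeas, hmin, le_antisymm ?_ ?_, fun τ => ⟨?_, ?_⟩⟩
  · refine iSup₂_le fun τ hτ => ?_
    obtain ⟨v, hv, rfl⟩ := (hfeas τ).1 hτ
    obtain ⟨α, hα, -, hobj⟩ := hmin v.τ hτ.1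
    rw [hobj, DRCCMDP.neg_coe_mul_le_neg_coe_mul_iff hc]
    exact iInf₂_le_of_le { v with α := α } (hv.with_α hα) le_rfl
  -- Writing the supremum as the image of some `w` under the order-reversing scaling lets that
  -- scaling be cancelled, infinite values included.
  · obtain ⟨w, hw⟩ := DRCCMDP.exists_neg_coe_mul_eq hc (⨆ τ ∈ DRCCMDP.robustFeasible M.occ
      (fun k : Fin K => DRCCMDP.mixture (ω k.succ) (P k.succ)) (fun k => δ k.succ) ξ ε,
        DRCCMDP.robustObjective M.β (DRCCMDP.mixture (ω 0) (P 0)) (δ 0) τ)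
    rw [hw, DRCCMDP.neg_coe_mul_le_neg_coe_mul_iff hc]
    refine le_iInf₂ fun v hv => ?_
    have hτ := (hfeas v.τ).2 ⟨v, hv, rfl⟩
    obtain ⟨α, -, hαmin, hobj⟩ := hmin v.τ hτ.1
    refine le_trans ?_ (hαmin v.α hv.α_nonneg)
    rw [← DRCCMDP.neg_coe_mul_le_neg_coe_mul_iff hc, ← hobj, ← hw]
    exact le_iSup₂_of_le v.τ hτ le_rfl
  · rintro ⟨hτ, hmax⟩
    obtain ⟨v, hv, rfl⟩ := (hfeas τ).1 hτ
    obtain ⟨α, hα, -, hobj⟩ := hmin v.τ hτ.1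
    -- The minimising `α` may be substituted, since only `0 ≤ α` constrains it.
    refine ⟨{ v with α := α }, hv.with_α hα, fun u hu => ?_, rfl⟩
    have hu' := (hfeas u.τ).2 ⟨u, hu, rfl⟩
    obtain ⟨α', -, hαmin', hobj'⟩ := hmin u.τ hu'.1
    refine le_trans ?_ (hαmin' u.α hu.α_nonneg)
    rw [← DRCCMDP.neg_coe_mul_le_neg_coe_mul_iff hc, ← hobj, ← hobj']
    exact hmax hu'
  · rintro ⟨v, hv, hvmin, rfl⟩
    have hτ := (hfeas v.τ).2 ⟨v, hv, rfl⟩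
    refine ⟨hτ, fun τ' hτ' => ?_⟩
    obtain ⟨u, hu, rfl⟩ := (hfeas τ').1 hτ'
    obtain ⟨α, hα, hαmin, hobj⟩ := hmin v.τ hτ.1
    obtain ⟨α', hα', -, hobj'⟩ := hmin u.τ hτ'.1
    change DRCCMDP.robustObjective _ _ _ _ ≤ DRCCMDP.robustObjective _ _ _ _
    rw [hobj, hobj', DRCCMDP.neg_coe_mul_le_neg_coe_mul_iff hc]
    exact (hαmin v.α hv.α_nonneg).trans (hvmin (hu.with_α hα'))
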